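/- Consider a single-location lost-sales system with lead time $L\ge 1$ (in cycles) whose replenishment cycles consist of $T$ periods. There are $M\ge 2$ customer types with rewards $0<r_1<\dots<r_M$; in each period, independently of all others, a type-$j$ customer arrives with probability $\lambda_j\ge 0$ and nobody arrives with probability $\lambda_0=1-\sum_{j=1}^M\lambda_j$. Assume $\lambda_M>0$ and $\lambda_0>0$. Leftover inventory at the end of a cycle costs $h>0$ per unit. The numbers $M,L,r_j,\lambda_j,h$ do not depend on $T$. Under the base-stock policy with level $S\in\mathbb N$, at the start of each cycle an order is placed, arriving $L$ cycles later, which raises the inventory position (on-hand inventory plus all outstanding orders) to $S$; the initial state is any state of nonnegative integers with inventory position at most $S$ (it may depend on $T$, on $S$ and on the fulfillment algorithm). The greedy algorithm accepts every arriving customer while inventory is available; the myopic offline algorithm knows all arrivals of the current cycle and serves them from the highest type to the lowest until the on-hand inventory is used up. For $\mathrm{alg}\in\{\mathrm{off},\mathrm{greedy}\}$ let $\pi^{\mathrm{alg}}_{\mathbf b}(T,S,N)$ be the expected average over $N$ cycles of the per-cycle profit (rewards of accepted customers minus $h$ times the end-of-cycle leftover), and $\pi^{\mathrm{alg}}_{\mathbf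 b}(T,S,\infty)=\lim_{N\to\infty}\pi^{\mathrm{alg}}_{\mathbf b}(T,S,N)$. For each $T$ let $\mathcal S_T\subseteq\mathbb N$ be a set of admissible base-stock levels (for instance $\mathcal S_T=\mathbb N$), and for all large $T$ let $S^{\mathrm{off}}_T$ and $S^{\mathrm{greedy}}_T$ maximize $\pi^{\mathrm{off}}_{\mathbf b}(T,\cdot,\infty)$ and $\pi^{\mathrm{greedy}}_{\mathbf b}(T,\cdot,\infty)$, respectively, over $\mathcal S_T$. Let $\tfrac12<\beta\le 1$, and suppose that $S_T=S^{\mathrm{off}}_T$ and $S_T=S^{\mathrm{greedy}}_T$ are both in the interior base-stock regime with this exponent: for all large $T$, $$(L+1)T\lambda_M<S_T<(L+1)T(1-\lambda_0)\qquad\text{and}\qquad K_1T^\beta\le (L+1)T(1-\lambda_0)-S_T\le K_2T^\beta$$ for some constants $0<K_1\le K_2$ independent of $T$. Then the limits defining $\pi^{\mathrm{off}}_{\mathbf b}(T,S,\infty)$ and $\pi^{\mathrm{greedy}}_{\mathbf b}(T,S,\infty)$ exist for all $T$, $S$ and all admissible initial states, and $$\pi^{\mathrm{off}}_{\mathbf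 b}(T,S^{\mathrm{off}}_T,\infty)-\pi^{\mathrm{greedy}}_{\mathbf b}(T,S^{\mathrm{greedy}}_T,\infty)=\Theta(T^\beta),$$ i.e. there are constants $0<c\le C$ such that for all large $T$ the left-hand side lies between $cT^\beta$ and $CT^\beta$. -/

import Mathlib

open Filter Topology

namespace Replenishment

/-- The arrivals in the `T` periods of one cycle: `some j` is a customer of type `j`, `none` is a
period without a customer. Types are indexed by `Fin M`, so type `j` of the usual numbering
`1, ..., M` is index `j - 1`. -/
abbrev CycleArrivals (M T : ℕ) := Fin T → Option (Fin M)

/-- A fulfillment rule says, from the start-of-cycle inventory and the arrivals of the cycle,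
whether it wants to accept the customer of period `t`. Feasibility (there must be a customer and a
unit in stock) is imposed separately, in `acceptGiven`. -/
abbrev FulfillmentRule (M T : ℕ) := ℕ → CycleArrivals M T → Fin T → Bool

/-- The online greedy rule: accept every customer (as long as inventory is available). -/
def greedyRule (M T : ℕ) : FulfillmentRule M T := fun _ _ _ => true

/-- The periods of the cycle whose customers come before that of period `t` when customers are
sorted from the highest type to the lowest, ties being broken by the time of arrival. -/
def preferred {M T : ℕ} (a : CycleArrivals M T) (t : Fin T) : Finset (Fin T) :=
  Finset.univ.filter fun s =>
    ∃ i j : Fin M, a s = some i ∧ a t = some j ∧ (j < i ∨ (i = j ∧ s < t))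

/-- The myopic offline rule: knowing the arrivals of the whole cycle, serve the customers from the
highest type to the lowest until the start-of-cycle inventory `I` is exhausted. -/
def offlineRule (M T : ℕ) : FulfillmentRule M T := fun I a t => decide ((preferred a t).card < I)

/-- The acceptance indicator of period `t`, given the current stock. -/
def acceptGiven {M T : ℕ} (rule : FulfillmentRule M T) (I : ℕ) (a : CycleArrivals M T)
    (t : Fin T) (stock : ℕ) : ℕ :=
  if (a t).isSome = true ∧ 0 < stock ∧ rule I a t = true then 1 else 0

/-- `stockBefore rule I a t` is the on-hand inventory after the first `t` periods of a cycle that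
starts with inventory `I`; so `stockBefore rule I a T` is the end-of-cycle leftover. -/
def stockBefore {M T : ℕ} (rule : FulfillmentRule M T) (I : ℕ) (a : CycleArrivals M T) : ℕ → ℕ
  | 0 => I
  | t + 1 => stockBefore rule I a t -
      (if ht : t < T then acceptGiven rule I a ⟨t, ht⟩ (stockBefore rule I a t) else 0)

/-- The acceptance indicator of period `t` in a cycle that starts with inventory `I`. -/
def accept {M T : ℕ} (rule : FulfillmentRule M T) (I : ℕ) (a : CycleArrivals M T)
    (t : Fin T) : ℕ :=
  acceptGiven rule I a t (stockBefore rule I a t)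

/-- The profit of one cycle: rewards of the accepted customers minus the holding cost of the
leftover. -/
noncomputable def cycleProfit {M T : ℕ} (r : Fin M → ℝ) (h : ℝ) (rule : FulfillmentRule M T)
    (I : ℕ) (a : CycleArrivals M T) : ℝ :=
  (∑ t : Fin T, (a t).elim 0 r * (accept rule I a t : ℝ)) - h * (stockBefore rule I a T : ℝ)

/-- The state at the start of a cycle `n` for lead time `L ≥ 1`: the on-hand inventory (after the
order due in cycle `n` has arrived) and the `L - 1` outstanding orders, `orders i` being the one
that arrives at the start of cycle `n + 1 + i`. -/
structure SystemState (L : ℕ) where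
  onHand : ℕ
  orders : Fin (L - 1) → ℕ

/-- The inventory position before the order of the current cycle is placed. -/
def SystemState.position {L : ℕ} (s : SystemState L) : ℕ := s.onHand + ∑ i, s.orders i

/-- The order that raises the inventory position to the base-stock level `S`. -/
def newOrder {L : ℕ} (S : ℕ) (s : SystemState L) : ℕ := S - s.position

/-- All outstanding orders after the new order has been placed; the new one arrives last. -/
def outstanding {L : ℕ} (S : ℕ) (s : SystemState L) (i : Fin L) : ℕ :=
  if hi : i.val < L - 1 then s.orders ⟨i, hi⟩ else newOrder S s

/-- The state at the start of the next cycle, if the current cycle ends with the given leftover. -/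
def nextState {L : ℕ} [NeZero L] (S : ℕ) (s : SystemState L) (leftover : ℕ) : SystemState L where
  onHand := leftover + outstanding S s 0
  orders := fun i => outstanding S s ⟨i.val + 1, by have := i.isLt; omega⟩

/-- The state at the start of each cycle (cycles numbered from `0`) under the base-stock policy with
level `S`, from the initial state `s₀`, along the arrivals `H`. -/
def stateAt {M T L : ℕ} [NeZero L] (rule : FulfillmentRule M T) (S : ℕ) (s₀ : SystemState L)
    (H : ℕ → CycleArrivals M T) : ℕ → SystemState L
  | 0 => s₀
  | n + 1 => nextState S (stateAt rule S s₀ H n)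
      (stockBefore rule (stateAt rule S s₀ H n).onHand (H n) T)

/-- The law of the arrival in one period. -/
noncomputable def arrivalProb {M : ℕ} (lam : Fin M → ℝ) : Option (Fin M) → ℝ
  | none => 1 - ∑ j, lam j
  | some j => lam j

/-- The probability of a demand path over `N` cycles: arrivals are i.i.d. across periods and
cycles. -/
noncomputable def pathProb {M T N : ℕ} (lam : Fin M → ℝ) (H : Fin N → CycleArrivals M T) : ℝ :=
  ∏ n, ∏ t, arrivalProb lam (H n t)

/-- A path over `N` cycles continued by cycles without customers, which are never looked at in
`avgProfit`. -/
def extendPath {M T N : ℕ} (H : Fin N → CycleArrivals M T) : ℕ → CycleArrivals M T :=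
  fun n => if hn : n < N then H ⟨n, hn⟩ else fun _ => none

/-- The expected average profit per cycle over `N` cycles under the base-stock policy with level
`S`. -/
noncomputable def avgProfit {M T L : ℕ} [NeZero L] (r lam : Fin M → ℝ) (h : ℝ)
    (rule : FulfillmentRule M T) (S : ℕ) (s₀ : SystemState L) (N : ℕ) : ℝ :=
  (1 / (N : ℝ)) * ∑ H : Fin N → CycleArrivals M T, pathProb lam H *
    ∑ n : Fin N, cycleProfit r h rule (stateAt rule S s₀ (extendPath H) n).onHand (H n)

/-- The long-run average profit per cycle. -/
noncomputable def longRunProfit {M T L : ℕ} [NeZero L] (r lam : Fin M → ℝ) (h : ℝ)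
    (rule : FulfillmentRule M T) (S : ℕ) (s₀ : SystemState L) : ℝ :=
  limUnder atTop (avgProfit r lam h rule S s₀)

/-- `S` maximizes `f` over the set `A` of base-stock levels. -/
def IsOptimalLevel (A : Set ℕ) (f : ℕ → ℝ) (S : ℕ) : Prop := S ∈ A ∧ ∀ S' ∈ A, f S' ≤ f S

/-- `f T = Θ(T ^ β)` for a function that is eventually positive. -/
def ThetaPow (f : ℕ → ℝ) (β : ℝ) : Prop :=
  ∃ K₁ K₂ : ℝ, 0 < K₁ ∧ K₁ ≤ K₂ ∧
    ∀ᶠ T : ℕ in atTop, K₁ * (T : ℝ) ^ β ≤ f T ∧ f T ≤ K₂ * (T : ℝ) ^ β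

/-- The slack `(L + 1) T (1 - λ₀) - S`, where `1 - λ₀ = ∑ j, λ_j`. -/
noncomputable def slack {M : ℕ} (L : ℕ) (lam : Fin M → ℝ) (T S : ℕ) : ℝ :=
  ((L : ℝ) + 1) * (T : ℝ) * (∑ j, lam j) - (S : ℝ)

/-- The levels `S T` (one for each cycle length `T`) are in the interior base-stock regime with
exponent `β`; `lamTop` is the arrival probability of the highest type. -/
def InteriorRegime {M : ℕ} (L : ℕ) (lam : Fin M → ℝ) (lamTop β : ℝ) (S : ℕ → ℕ) : Prop :=
  (∀ᶠ T : ℕ in atTop, ((L : ℝ) + 1) * (T : ℝ) * lamTop < (S T : ℝ) ∧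
    (S T : ℝ) < ((L : ℝ) + 1) * (T : ℝ) * ∑ j, lam j) ∧
  ThetaPow (fun T => slack L lam T (S T)) β

end Replenishment

namespace Replenishment

/-! Both rules end a cycle with `I - demand a` units, so at a common base-stock level they drive the
same Markov chain of states. The long-run profits at a common level therefore differ by the
stationary mean of `gapMean`, the expected one-cycle reward advantage of serving by type
(`longRunProfit_offline_sub_greedy`). Optimality removes the mismatch of levels: the difference in
question is at least this stationary mean at the greedy optimum and at most the one at the offline
optimum. It remains to show that the mean is of order `T ^ β` at any level in the interior regime.
Write `p` for the total arrival probability.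

Upper bound (`stationaryMean_gapMean_le`): the advantage is at most the top reward times the lost
sales. Stock on hand plus the sales of the preceding `L` cycles equals `S`, so lost sales are at
most the slack plus the demand deviations of `L + 1` cycles. These have mean at most `√T` each,
which is negligible since `β > 1/2`.

Lower bound: let `γ` be the slack divided by `2 (L + 1)`. If a cycle starts with a stock that is at
least linear in `T` but at most `T p - γ`, greedy typically runs out about `γ / 2` periods early. It
then misses a number of top-type customers of order `γ`, having served as many of a lower type
before (`exists_mul_le_gapMean`).

Such moderate stocks have stationary probability bounded below. In any `2 L + 2` consecutive cycles
there is a moderate stock, or a cycle with low demand, or a large stock followed by a small incoming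
order (`exists_moderate_or_drop_or_low`). Low demand is rare by Chebyshev's inequality, where `β >
1/2` enters. The last case is rare by a drift argument: a potential measuring shortfalls strictly
drops when this case meets one particular demand, and rises only for demands that are exponentially
less likely (`stationaryMean_large_small_le`). Stationary means exist because `L` cycles without
customers bring every state to the same one, which is a Doeblin condition. -/

/-! ### One cycle: the customers served by each rule and the leftover. -/

/-- The periods of the cycle in which a customer arrives. -/
def arrivals {M T : ℕ} (a : CycleArrivals M T) : Finset (Fin T) :=
  Finset.univ.filter fun t => (a t).isSome = true

/-- The number of customers of the cycle. -/
def demand {M T : ℕ} (a : CycleArrivals M T) : ℕ := (arrivals a).card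

/-- The number of customers in the first `n` periods of the cycle. -/
def arrivalsBefore {M T : ℕ} (a : CycleArrivals M T) (n : ℕ) : ℕ :=
  ((arrivals a).filter fun t => t.val < n).card

/-- The customers served by the myopic offline rule. -/
def offlineServed {M T : ℕ} (I : ℕ) (a : CycleArrivals M T) : Finset (Fin T) :=
  (arrivals a).filter fun t => (preferred a t).card < I

/-- The customers served by the greedy rule. -/
def greedyServed {M T : ℕ} (I : ℕ) (a : CycleArrivals M T) : Finset (Fin T) :=
  (arrivals a).filter fun t => arrivalsBefore a t < I

/-- The reward offered in period `t`. -/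
noncomputable def rewardAt {M T : ℕ} (r : Fin M → ℝ) (a : CycleArrivals M T) (t : Fin T) : ℝ :=
  (a t).elim 0 r

lemma mem_arrivals {M T : ℕ} {a : CycleArrivals M T} {t : Fin T} :
    t ∈ arrivals a ↔ ∃ i, a t = some i := by
  simp [arrivals, Option.isSome_iff_exists]

lemma offlineServed_subset {M T : ℕ} (I : ℕ) (a : CycleArrivals M T) :
    offlineServed I a ⊆ arrivals a := Finset.filter_subset _ _

lemma greedyServed_subset {M T : ℕ} (I : ℕ) (a : CycleArrivals M T) :
    greedyServed I a ⊆ arrivals a := Finset.filter_subset _ _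

lemma mem_preferred {M T : ℕ} {a : CycleArrivals M T} {s t : Fin T} :
    s ∈ preferred a t ↔
      ∃ i j : Fin M, a s = some i ∧ a t = some j ∧ (j < i ∨ (i = j ∧ s < t)) := by
  simp [preferred]

/-- The induction step that turns the period-by-period stock recursion into closed formulas, for
both rules. -/
lemma card_filter_lt_succ {T : ℕ} (O : Finset (Fin T)) (n : ℕ) :
    (O.filter fun t => t.val < n + 1).card
      = (O.filter fun t => t.val < n).card
        + (if hn : n < T then (if (⟨n, hn⟩ : Fin T) ∈ O then 1 else 0) else 0) := by
  split_ifs with hn hO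
  · have : (O.filter fun t : Fin T => t.val < n + 1)
        = insert ⟨n, hn⟩ (O.filter fun t : Fin T => t.val < n) := by
      ext t
      simp only [Finset.mem_filter, Finset.mem_insert, Fin.ext_iff]
      constructor
      · rintro ⟨h1, h2⟩
        rcases Nat.lt_succ_iff_lt_or_eq.1 h2 with h | h
        · exact Or.inr ⟨h1, h⟩
        · exact Or.inl h
      · rintro (h | ⟨h1, h2⟩)
        · have : t = ⟨n, hn⟩ := Fin.ext h
          exact ⟨this ▸ hO, by omega⟩
        · exact ⟨h1, by omega⟩
    rw [this, Finset.card_insert_of_notMem (by simp)]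
  · congr 1
    ext t
    simp only [Finset.mem_filter]
    refine and_congr_right fun ht => ⟨fun h => ?_, fun h => by omega⟩
    rcases Nat.lt_succ_iff_lt_or_eq.1 h with h | h
    · exact h
    · exact absurd ((Fin.ext h : t = ⟨n, hn⟩) ▸ ht) hO
  · congr 1
    ext t
    have := t.isLt
    simp only [Finset.mem_filter]
    exact and_congr_right fun ht => ⟨fun h => by omega, fun h => by omega⟩

lemma filter_lt_self {T : ℕ} (O : Finset (Fin T)) : (O.filter fun t => t.val < T) = O :=
  Finset.filter_true_of_mem fun t _ => t.isLt

lemma arrivalsBefore_self {M T : ℕ} (a : CycleArrivals M T) : arrivalsBefore a T = demand a := by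
  rw [arrivalsBefore, filter_lt_self, demand]

lemma arrivalsBefore_mono {M T : ℕ} (a : CycleArrivals M T) : Monotone (arrivalsBefore a) :=
  fun m n hmn => Finset.card_le_card fun t ht => by
    simp only [Finset.mem_filter] at ht ⊢
    exact ⟨ht.1, by omega⟩

lemma arrivalsBefore_le {M T : ℕ} (a : CycleArrivals M T) (n : ℕ) : arrivalsBefore a n ≤ n := by
  induction n with
  | zero => simp [arrivalsBefore]
  | succ n ih =>
    have := card_filter_lt_succ (arrivals a) n
    unfold arrivalsBefore at *
    split_ifs at this <;> omega

lemma stockBefore_greedy {M T : ℕ} (I : ℕ) (a : CycleArrivals M T) (n : ℕ) :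
    stockBefore (greedyRule M T) I a n = I - arrivalsBefore a n := by
  induction n with
  | zero => simp [stockBefore, arrivalsBefore]
  | succ n ih =>
    have h := card_filter_lt_succ (arrivals a) n
    rw [stockBefore, ih]
    unfold arrivalsBefore at *
    rw [h]
    by_cases hn : n < T
    · simp only [hn, dite_true, acceptGiven, greedyRule, and_true, arrivals, Finset.mem_filter,
        Finset.mem_univ, true_and]
      split_ifs <;> simp_all <;> omega
    · simp [hn]

lemma accept_greedy {M T : ℕ} (I : ℕ) (a : CycleArrivals M T) (t : Fin T) :
    accept (greedyRule M T) I a t = if t ∈ greedyServed I a then 1 else 0 := by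
  simp [accept, acceptGiven, stockBefore_greedy, greedyRule, greedyServed, arrivals]

lemma leftover_greedy {M T : ℕ} (I : ℕ) (a : CycleArrivals M T) :
    stockBefore (greedyRule M T) I a T = I - demand a := by
  rw [stockBefore_greedy, arrivalsBefore_self]

/-- Being preferred is transitive and irreflexive. With totality on the arrivals, `(preferred a
t).card` becomes the rank of customer `t`. -/
lemma card_preferred_lt {M T : ℕ} {a : CycleArrivals M T} {s t : Fin T}
    (h : s ∈ preferred a t) : (preferred a s).card < (preferred a t).card := by
  refine Finset.card_lt_card ⟨fun u hu => ?_, fun hsub => ?_⟩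
  · rw [mem_preferred] at *
    obtain ⟨i, j, hi, hj, hij⟩ := h
    obtain ⟨k, l, hk, hl, hkl⟩ := hu
    obtain rfl : i = l := by simpa [hi] using hl
    refine ⟨k, j, hk, hj, ?_⟩
    rcases hij with hij | ⟨rfl, hij⟩ <;> rcases hkl with hkl | ⟨rfl, hkl⟩
    · exact Or.inl (hij.trans hkl)
    · exact Or.inl hij
    · exact Or.inl hkl
    · exact Or.inr ⟨rfl, hkl.trans hij⟩
  · obtain ⟨i, j, hi, hj, hij⟩ := mem_preferred.1 (hsub h)
    obtain rfl : i = j := by simpa [hi] using hj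
    simp at hij

lemma mem_preferred_or {M T : ℕ} {a : CycleArrivals M T} {s t : Fin T} (hs : s ∈ arrivals a)
    (ht : t ∈ arrivals a) (hst : s ≠ t) : s ∈ preferred a t ∨ t ∈ preferred a s := by
  obtain ⟨i, hi⟩ := mem_arrivals.1 hs
  obtain ⟨j, hj⟩ := mem_arrivals.1 ht
  simp only [mem_preferred, hi, hj, Option.some.injEq, exists_eq_left', exists_and_left]
  rcases lt_trichotomy i j with h | h | h
  · exact Or.inr (Or.inl h)
  · rcases lt_or_gt_of_ne hst with h' | h'
    · exact Or.inl (Or.inr ⟨h, h'⟩)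
    · exact Or.inr (Or.inr ⟨h.symm, h'⟩)
  · exact Or.inl (Or.inl h)

lemma card_preferred_injOn {M T : ℕ} (a : CycleArrivals M T) :
    Set.InjOn (fun t => (preferred a t).card) (arrivals a : Set (Fin T)) := by
  intro s hs t ht hst
  by_contra hne
  rcases mem_preferred_or hs ht hne with h | h
  · exact absurd hst (card_preferred_lt h).ne
  · exact absurd hst (card_preferred_lt h).ne'

lemma card_preferred_lt_demand {M T : ℕ} {a : CycleArrivals M T} {t : Fin T}
    (ht : t ∈ arrivals a) : (preferred a t).card < demand a := by
  refine Finset.card_lt_card ⟨fun s hs => ?_, fun hsub => ?_⟩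
  · obtain ⟨i, j, hi, -⟩ := mem_preferred.1 hs
    exact mem_arrivals.2 ⟨i, hi⟩
  · exact lt_irrefl _ (card_preferred_lt (hsub ht))

lemma image_card_preferred {M T : ℕ} (a : CycleArrivals M T) :
    (arrivals a).image (fun t => (preferred a t).card) = Finset.range (demand a) := by
  refine Finset.eq_of_subset_of_card_le (fun k hk => ?_) ?_
  · obtain ⟨t, ht, rfl⟩ := Finset.mem_image.1 hk
    exact Finset.mem_range.2 (card_preferred_lt_demand ht)
  · rw [Finset.card_image_of_injOn (card_preferred_injOn a), Finset.card_range, demand]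

/-- The ranks are exactly the numbers below the demand, so the cutoff `I` keeps `min I (demand a)`
of them. -/
lemma card_offlineServed {M T : ℕ} (I : ℕ) (a : CycleArrivals M T) :
    (offlineServed I a).card = min I (demand a) := by
  rw [← Finset.card_image_of_injOn ((card_preferred_injOn a).mono
    (Finset.coe_subset.2 (offlineServed_subset I a)))]
  have : (offlineServed I a).image (fun t => (preferred a t).card)
      = (Finset.range (demand a)).filter (· < I) := by
    rw [← image_card_preferred, Finset.filter_image]
    rfl
  have h2 : (Finset.range (demand a)).filter (· < I) = Finset.range (min I (demand a)) := by
    ext k; simp [and_comm]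
  change ((offlineServed I a).image (fun t => (preferred a t).card)).card = _
  rw [this, h2, Finset.card_range]

/-- The stock constraint never binds: the rule selects at most `I` customers in the whole cycle, so
a selected one always finds a unit. -/
lemma stockBefore_offline {M T : ℕ} (I : ℕ) (a : CycleArrivals M T) (n : ℕ) :
    stockBefore (offlineRule M T) I a n
      = I - ((offlineServed I a).filter fun t => t.val < n).card := by
  induction n with
  | zero => simp [stockBefore]
  | succ n ih =>
    rw [stockBefore, ih, card_filter_lt_succ]
    by_cases hn : n < T
    · simp only [hn, dite_true]
      by_cases hO : (⟨n, hn⟩ : Fin T) ∈ offlineServed I a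
      · have hlt : ((offlineServed I a).filter fun t : Fin T => t.val < n).card < I := by
          refine lt_of_lt_of_le (Finset.card_lt_card ⟨Finset.filter_subset _ _, fun hs => ?_⟩)
            ((card_offlineServed I a).trans_le (min_le_left _ _))
          simpa using hs hO
        simp only [offlineServed, Finset.mem_filter, arrivals, Finset.mem_univ, true_and] at hO
        rw [acceptGiven, if_pos ⟨hO.1, by omega, by simpa [offlineRule] using hO.2⟩, if_pos]
        · omega
        · simpa [offlineServed, arrivals] using hO
      · rw [if_neg hO, acceptGiven, if_neg]
        · omega
        · simp only [offlineServed, Finset.mem_filter, arrivals, Finset.mem_univ, true_and] at hO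
          rintro ⟨h1, -, h3⟩
          exact hO ⟨h1, by simpa [offlineRule] using h3⟩
    · simp [hn]

lemma accept_offline {M T : ℕ} (I : ℕ) (a : CycleArrivals M T) (t : Fin T) :
    accept (offlineRule M T) I a t = if t ∈ offlineServed I a then 1 else 0 := by
  by_cases hO : t ∈ offlineServed I a
  · have hlt : ((offlineServed I a).filter fun s : Fin T => s.val < t.val).card < I := by
      refine lt_of_lt_of_le (Finset.card_lt_card ⟨Finset.filter_subset _ _, fun hs => ?_⟩)
        ((card_offlineServed I a).trans_le (min_le_left _ _))
      simpa using hs hO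
    rw [if_pos hO]
    simp only [offlineServed, Finset.mem_filter, arrivals, Finset.mem_univ, true_and] at hO
    rw [accept, acceptGiven, stockBefore_offline,
      if_pos ⟨hO.1, by omega, by simpa [offlineRule] using hO.2⟩]
  · rw [if_neg hO, accept, acceptGiven, if_neg]
    simp only [offlineServed, Finset.mem_filter, arrivals, Finset.mem_univ, true_and] at hO
    rintro ⟨h1, -, h3⟩
    exact hO ⟨h1, by simpa [offlineRule] using h3⟩

lemma leftover_offline {M T : ℕ} (I : ℕ) (a : CycleArrivals M T) :
    stockBefore (offlineRule M T) I a T = I - demand a := by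
  rw [stockBefore_offline, filter_lt_self, card_offlineServed]
  omega

lemma card_greedyServed {M T : ℕ} (I : ℕ) (a : CycleArrivals M T) :
    (greedyServed I a).card = min I (demand a) := by
  have key : ∀ n, ((greedyServed I a).filter fun t => t.val < n).card
      = min I (arrivalsBefore a n) := by
    intro n
    induction n with
    | zero => simp [arrivalsBefore]
    | succ n ih =>
      have h := card_filter_lt_succ (arrivals a) n
      rw [card_filter_lt_succ, ih]
      by_cases hn : n < T
      · simp only [hn, dite_true, greedyServed, Finset.mem_filter] at h ⊢
        unfold arrivalsBefore at *
        rw [h]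
        split_ifs <;> simp_all <;> omega
      · simp only [hn, dite_false, add_zero] at h ⊢
        unfold arrivalsBefore
        rw [h]
  have := key T
  rwa [filter_lt_self, arrivalsBefore_self] at this

lemma cycleProfit_offline {M T : ℕ} (r : Fin M → ℝ) (h : ℝ) (I : ℕ) (a : CycleArrivals M T) :
    cycleProfit r h (offlineRule M T) I a
      = ∑ t ∈ offlineServed I a, rewardAt r a t - h * ((I - demand a : ℕ) : ℝ) := by
  simp [cycleProfit, leftover_offline, accept_offline, rewardAt]

lemma cycleProfit_greedy {M T : ℕ} (r : Fin M → ℝ) (h : ℝ) (I : ℕ) (a : CycleArrivals M T) :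
    cycleProfit r h (greedyRule M T) I a
      = ∑ t ∈ greedyServed I a, rewardAt r a t - h * ((I - demand a : ℕ) : ℝ) := by
  simp [cycleProfit, leftover_greedy, accept_greedy, rewardAt]

/-! ### The reward advantage of the offline rule along one path. -/

/-- The offline rule collects at least the rewards of any set of customers that is not larger
than the set it serves. -/
lemma sum_rewardAt_le_offline {M T : ℕ} {r : Fin M → ℝ} (hr : StrictMono r) (hr0 : ∀ j, 0 < r j)
    (I : ℕ) (a : CycleArrivals M T) {B : Finset (Fin T)} (hB : B ⊆ arrivals a)
    (hcard : B.card ≤ (offlineServed I a).card) :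
    ∑ t ∈ B, rewardAt r a t ≤ ∑ t ∈ offlineServed I a, rewardAt r a t := by
  classical
  set O := offlineServed I a with hO
  have hpos : ∀ t, 0 ≤ rewardAt r a t := fun t => by
    unfold rewardAt
    cases a t with
    | none => simp
    | some i => exact (hr0 i).le
  rw [← Finset.sum_sdiff_le_sum_sdiff]
  rcases (B \ O).eq_empty_or_nonempty with he | hne
  · rw [he, Finset.sum_empty]
    exact Finset.sum_nonneg fun t _ => hpos t
  · obtain ⟨s, hs, hmax⟩ := Finset.exists_max_image (B \ O) (rewardAt r a) hne
    have hsA : s ∈ arrivals a := hB (Finset.mem_sdiff.1 hs).1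
    have hsO : s ∉ O := (Finset.mem_sdiff.1 hs).2
    -- The served set is closed under passing to preferred customers, so nobody in it has a lower
    -- type than the unserved `s`.
    have hmin : ∀ t ∈ O \ B, rewardAt r a s ≤ rewardAt r a t := by
      intro t ht
      have htO := (Finset.mem_sdiff.1 ht).1
      have htA : t ∈ arrivals a := Finset.mem_of_mem_filter _ htO
      have h1 : (preferred a t).card < I := (Finset.mem_filter.1 htO).2
      have h2 : ¬ (preferred a s).card < I := fun h => hsO (Finset.mem_filter.2 ⟨hsA, h⟩)
      obtain ⟨i, hi⟩ := mem_arrivals.1 hsA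
      obtain ⟨j, hj⟩ := mem_arrivals.1 htA
      simp only [rewardAt, hi, hj, Option.elim_some]
      refine hr.monotone (not_lt.1 fun hlt => ?_)
      have := card_preferred_lt (mem_preferred.2 ⟨i, j, hi, hj, Or.inl hlt⟩ : s ∈ preferred a t)
      omega
    have hc : (B \ O).card ≤ (O \ B).card := by
      have h1 := Finset.card_sdiff_add_card_inter B O
      have h2 := Finset.card_sdiff_add_card_inter O B
      rw [Finset.inter_comm] at h2
      omega
    calc ∑ t ∈ B \ O, rewardAt r a t ≤ (B \ O).card • rewardAt r a s :=
          Finset.sum_le_card_nsmul _ _ _ hmax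
      _ ≤ (O \ B).card • rewardAt r a s := nsmul_le_nsmul_left (hpos s) hc
      _ ≤ ∑ t ∈ O \ B, rewardAt r a t := Finset.card_nsmul_le_sum _ _ _ hmin

/-- The advantage of the myopic offline rule over the greedy rule in one cycle. -/
noncomputable def rewardGap {M T : ℕ} (r : Fin M → ℝ) (I : ℕ) (a : CycleArrivals M T) : ℝ :=
  ∑ t ∈ offlineServed I a, rewardAt r a t - ∑ t ∈ greedyServed I a, rewardAt r a t

lemma rewardGap_nonneg {M T : ℕ} {r : Fin M → ℝ} (hr : StrictMono r) (hr0 : ∀ j, 0 < r j)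
    (I : ℕ) (a : CycleArrivals M T) : 0 ≤ rewardGap r I a :=
  sub_nonneg.2 (sum_rewardAt_le_offline hr hr0 I a (Finset.filter_subset _ _)
    (by rw [card_greedyServed, card_offlineServed]))

/-- The offline rule earns at most the rewards of all arrivals, and greedy misses exactly `demand a
- I` of these. -/
lemma rewardGap_le {M T : ℕ} {r : Fin M → ℝ} {R : ℝ} (hr0 : ∀ j, 0 < r j) (hR : ∀ j, r j ≤ R)
    (hR0 : 0 ≤ R) (I : ℕ) (a : CycleArrivals M T) :
    rewardGap r I a ≤ R * ((demand a - I : ℕ) : ℝ) := by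
  have hpos : ∀ t, 0 ≤ rewardAt r a t := fun t => by
    unfold rewardAt
    cases a t with
    | none => simp
    | some i => exact (hr0 i).le
  have hle : ∀ t, rewardAt r a t ≤ R := fun t => by
    unfold rewardAt
    cases a t with
    | none => simpa using hR0
    | some i => exact hR i
  have h1 : ∑ t ∈ offlineServed I a, rewardAt r a t ≤ ∑ t ∈ arrivals a, rewardAt r a t :=
    Finset.sum_le_sum_of_subset_of_nonneg (Finset.filter_subset _ _) fun t _ _ => hpos t
  have h2 := Finset.sum_sdiff (f := rewardAt r a)
    (greedyServed_subset I a)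
  have h3 : ∑ t ∈ arrivals a \ greedyServed I a, rewardAt r a t
      ≤ (arrivals a \ greedyServed I a).card • R :=
    Finset.sum_le_card_nsmul _ _ _ fun t _ => hle t
  have h4 : (arrivals a \ greedyServed I a).card = demand a - I := by
    rw [Finset.card_sdiff_of_subset (greedyServed_subset I a),
      card_greedyServed, demand]
    omega
  rw [h4, nsmul_eq_mul, mul_comm] at h3
  unfold rewardGap
  linarith

/-- Replacing low-type customers served early by top-type customers who come too late for the
greedy rule. -/
lemma le_rewardGap {M T : ℕ} {r : Fin M → ℝ} (hr : StrictMono r) (hr0 : ∀ j, 0 < r j)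
    {I : ℕ} {a : CycleArrivals M T} {i j : Fin M} {t₁ t₂ k : ℕ}
    (h₁ : t₁ ≤ I) (h₂ : I ≤ arrivalsBefore a t₂)
    (hX : k ≤ (Finset.univ.filter fun t : Fin T => t.val < t₁ ∧ a t = some i).card)
    (hY : k ≤ (Finset.univ.filter fun t : Fin T => t₂ ≤ t.val ∧ a t = some j).card) :
    (r j - r i) * k ≤ rewardGap r I a := by
  classical
  obtain ⟨X, hXs, hXc⟩ := Finset.exists_subset_card_eq hX
  obtain ⟨Y, hYs, hYc⟩ := Finset.exists_subset_card_eq hY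
  set G := greedyServed I a with hG
  have hX' : ∀ t ∈ X, t.val < t₁ ∧ a t = some i := fun t ht => by simpa using hXs ht
  have hY' : ∀ t ∈ Y, t₂ ≤ t.val ∧ a t = some j := fun t ht => by simpa using hYs ht
  -- At most one unit leaves per period, so nobody before period `t₁ ≤ I` is turned away.
  have hXG : X ⊆ G := fun t ht => by
    obtain ⟨h, hi⟩ := hX' t ht
    refine Finset.mem_filter.2 ⟨mem_arrivals.2 ⟨i, hi⟩, ?_⟩
    have := arrivalsBefore_le a t
    omega
  -- By period `t₂` at least `I` customers have come, so greedy has nothing left.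
  have hYG : Disjoint Y G := Finset.disjoint_left.2 fun t ht htG => by
    obtain ⟨h, -⟩ := hY' t ht
    have h3 := (Finset.mem_filter.1 htG).2
    have := arrivalsBefore_mono a h
    omega
  have hd : Disjoint (G \ X) Y := (hYG.mono_right Finset.sdiff_subset).symm
  have hsX : ∑ t ∈ X, rewardAt r a t = k * r i := by
    rw [Finset.sum_congr rfl fun t ht => (by simp [rewardAt, (hX' t ht).2] : _ = r i)]
    simp [hXc]
  have hsY : ∑ t ∈ Y, rewardAt r a t = k * r j := by
    rw [Finset.sum_congr rfl fun t ht => (by simp [rewardAt, (hY' t ht).2] : _ = r j)]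
    simp [hYc]
  have hs := Finset.sum_sdiff (f := rewardAt r a) hXG
  -- Exchanging `X` for `Y` keeps the size of the greedy set, so the offline rule earns at least as
  -- much as the exchanged set.
  have hB := sum_rewardAt_le_offline hr hr0 I a (B := (G \ X) ∪ Y) ?_ ?_
  · rw [Finset.sum_union hd, hsY] at hB
    rw [hsX] at hs
    unfold rewardGap
    linarith
  · refine Finset.union_subset (Finset.sdiff_subset.trans (Finset.filter_subset _ _)) fun t ht =>
      mem_arrivals.2 ⟨j, (hY' t ht).2⟩
  · rw [Finset.card_union_of_disjoint hd, Finset.card_sdiff_of_subset hXG, card_offlineServed,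
      ← card_greedyServed, ← hG, hXc, hYc]
    have := Finset.card_le_card hXG
    omega

lemma cycleProfit_offline_sub_greedy {M T : ℕ} (r : Fin M → ℝ) (h : ℝ) (I : ℕ)
    (a : CycleArrivals M T) :
    cycleProfit r h (offlineRule M T) I a - cycleProfit r h (greedyRule M T) I a
      = rewardGap r I a := by
  rw [cycleProfit_offline, cycleProfit_greedy, rewardGap]
  ring

/-! ### Expectations over the arrivals of one cycle. -/

/-- The probability of the arrivals of one cycle. -/
noncomputable def cycleProb {M T : ℕ} (lam : Fin M → ℝ) (a : CycleArrivals M T) : ℝ :=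
  ∏ t, arrivalProb lam (a t)

/-- The expectation of a function of the arrivals of one cycle. -/
noncomputable def cycleExp {M T : ℕ} (lam : Fin M → ℝ) (F : CycleArrivals M T → ℝ) : ℝ :=
  ∑ a, cycleProb lam a * F a

section Basic

variable {M T : ℕ} {lam : Fin M → ℝ}

lemma sum_arrivalProb (lam : Fin M → ℝ) : ∑ x, arrivalProb lam x = 1 := by
  rw [Fintype.sum_option]
  simp [arrivalProb]

lemma arrivalProb_nonneg (hlam : ∀ j, 0 ≤ lam j) (h0 : 0 < 1 - ∑ j, lam j) (x : Option (Fin M)) :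
    0 ≤ arrivalProb lam x := by
  cases x with
  | none => exact h0.le
  | some i => exact hlam i

lemma cycleProb_nonneg (hlam : ∀ j, 0 ≤ lam j) (h0 : 0 < 1 - ∑ j, lam j) (a : CycleArrivals M T) :
    0 ≤ cycleProb lam a := Finset.prod_nonneg fun _ _ => arrivalProb_nonneg hlam h0 _

/-- Independence of the periods; the total mass and the covariances are read off from it. -/
lemma cycleExp_prod (φ : Fin T → Option (Fin M) → ℝ) :
    cycleExp lam (fun a => ∏ t, φ t (a t)) = ∏ t, ∑ x, arrivalProb lam x * φ t x := by
  rw [Finset.prod_univ_sum, Fintype.piFinset_univ]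
  exact Finset.sum_congr rfl fun a _ => by rw [cycleProb, ← Finset.prod_mul_distrib]

lemma cycleExp_const (c : ℝ) : cycleExp lam (fun _ : CycleArrivals M T => c) = c := by
  have h := cycleExp_prod (lam := lam) (T := T) fun _ _ => 1
  simp only [Finset.prod_const_one, mul_one, sum_arrivalProb] at h
  unfold cycleExp at *
  rw [← Finset.sum_mul]
  simp only [mul_one] at h
  rw [h, one_mul]

lemma cycleExp_mono (hlam : ∀ j, 0 ≤ lam j) (h0 : 0 < 1 - ∑ j, lam j)
    {F G : CycleArrivals M T → ℝ} (h : ∀ a, F a ≤ G a) : cycleExp lam F ≤ cycleExp lam G :=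
  Finset.sum_le_sum fun a _ => mul_le_mul_of_nonneg_left (h a) (cycleProb_nonneg hlam h0 a)

lemma cycleExp_nonneg (hlam : ∀ j, 0 ≤ lam j) (h0 : 0 < 1 - ∑ j, lam j)
    {F : CycleArrivals M T → ℝ} (h : ∀ a, 0 ≤ F a) : 0 ≤ cycleExp lam F :=
  Finset.sum_nonneg fun a _ => mul_nonneg (cycleProb_nonneg hlam h0 a) (h a)

lemma cycleExp_add (F G : CycleArrivals M T → ℝ) :
    cycleExp lam (fun a => F a + G a) = cycleExp lam F + cycleExp lam G := by
  simp [cycleExp, mul_add, Finset.sum_add_distrib]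

lemma cycleExp_sub (F G : CycleArrivals M T → ℝ) :
    cycleExp lam (fun a => F a - G a) = cycleExp lam F - cycleExp lam G := by
  simp [cycleExp, mul_sub, Finset.sum_sub_distrib]

lemma cycleExp_const_mul (c : ℝ) (F : CycleArrivals M T → ℝ) :
    cycleExp lam (fun a => c * F a) = c * cycleExp lam F := by
  simp only [cycleExp, Finset.mul_sum]
  exact Finset.sum_congr rfl fun a _ => by ring

lemma cycleExp_sum {ι : Type*} (s : Finset ι) (F : ι → CycleArrivals M T → ℝ) :
    cycleExp lam (fun a => ∑ i ∈ s, F i a) = ∑ i ∈ s, cycleExp lam (F i) := by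
  simp only [cycleExp, Finset.mul_sum]
  exact Finset.sum_comm

end Basic

/-! ### Second moments and Chebyshev bounds for arrival counts. -/

/-- The number of periods in `J` whose arrival belongs to `B`. -/
def countIn {M T : ℕ} (J : Finset (Fin T)) (B : Finset (Option (Fin M)))
    (a : CycleArrivals M T) : ℕ := (J.filter fun t => a t ∈ B).card

section Count

variable {M T : ℕ} {lam : Fin M → ℝ}

/-- The variance bound for a number of arrivals. -/
lemma cycleExp_countIn_sq_le (hlam : ∀ j, 0 ≤ lam j) (h0 : 0 < 1 - ∑ j, lam j)
    (J : Finset (Fin T)) (B : Finset (Option (Fin M))) :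
    cycleExp lam (fun a => ((countIn J B a : ℝ) - J.card * ∑ x ∈ B, arrivalProb lam x) ^ 2)
      ≤ J.card := by
  classical
  set q := ∑ x ∈ B, arrivalProb lam x with hq
  set f : Option (Fin M) → ℝ := fun x => (if x ∈ B then 1 else 0) - q with hf
  have hq0 : 0 ≤ q := Finset.sum_nonneg fun x _ => arrivalProb_nonneg hlam h0 x
  have hq1 : q ≤ 1 := by
    rw [← sum_arrivalProb lam]
    exact Finset.sum_le_sum_of_subset_of_nonneg (Finset.subset_univ _)
      fun x _ _ => arrivalProb_nonneg hlam h0 x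
  have hmean : ∑ x, arrivalProb lam x * f x = 0 := by
    simp only [hf, mul_sub, Finset.sum_sub_distrib, ← Finset.sum_mul, sum_arrivalProb]
    simp [← hq]
  -- Centred indicators of different periods are uncorrelated: the product over periods has a
  -- vanishing factor at `s`.
  have hcov : ∀ s t : Fin T, s ≠ t → cycleExp lam (fun a => f (a s) * f (a t)) = 0 := by
    intro s t hst
    have h := cycleExp_prod (lam := lam) (T := T)
      fun u x => (if u = s then f x else 1) * (if u = t then f x else 1)
    simp only [Finset.prod_mul_distrib, Finset.prod_ite_eq', Finset.mem_univ, if_true] at h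
    rw [h]
    exact Finset.prod_eq_zero (Finset.mem_univ s) (by simp [hst, hmean])
  have hvar : ∀ s : Fin T, cycleExp lam (fun a => f (a s) * f (a s)) ≤ 1 := by
    intro s
    rw [← cycleExp_const (M := M) (T := T) (lam := lam) 1]
    refine cycleExp_mono hlam h0 fun a => ?_
    simp only [hf]
    split_ifs <;> nlinarith
  have hsum : ∀ a : CycleArrivals M T, ((countIn J B a : ℝ) - J.card * q) ^ 2
      = ∑ s ∈ J, ∑ t ∈ J, f (a s) * f (a t) := by
    intro a
    rw [← Finset.sum_mul_sum, ← pow_two]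
    simp [hf, countIn, Finset.sum_sub_distrib]
  simp only [hsum, cycleExp_sum]
  calc ∑ s ∈ J, ∑ t ∈ J, cycleExp lam (fun a => f (a s) * f (a t))
      ≤ ∑ s ∈ J, 1 := by
        refine Finset.sum_le_sum fun s hs => ?_
        rw [Finset.sum_eq_single_of_mem s hs fun t _ hts => hcov s t hts.symm]
        exact hvar s
    _ = J.card := by simp

lemma cycleExp_dev_le (hlam : ∀ j, 0 ≤ lam j) (h0 : 0 < 1 - ∑ j, lam j)
    (J : Finset (Fin T)) (B : Finset (Option (Fin M))) {u : ℝ} (hu : 0 < u) :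
    cycleExp lam (fun a => if u ≤ |(countIn J B a : ℝ) - J.card * ∑ x ∈ B, arrivalProb lam x|
      then 1 else 0) ≤ J.card / u ^ 2 := by
  rw [le_div_iff₀ (by positivity), mul_comm, ← cycleExp_const_mul]
  refine le_trans (cycleExp_mono hlam h0 fun a => ?_) (cycleExp_countIn_sq_le hlam h0 J B)
  split_ifs with h
  · rw [mul_one, ← sq_abs ((countIn J B a : ℝ) - _)]
    exact pow_le_pow_left₀ hu.le h 2
  · rw [mul_zero]
    positivity

/-- Chebyshev's inequality for the lower tail of a number of arrivals. -/
lemma cycleExp_countIn_lt_le (hlam : ∀ j, 0 ≤ lam j) (h0 : 0 < 1 - ∑ j, lam j)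
    (J : Finset (Fin T)) (B : Finset (Option (Fin M))) {u v : ℝ} (hu : 0 < u)
    (hv : v + u ≤ J.card * ∑ x ∈ B, arrivalProb lam x) :
    cycleExp lam (fun a => if (countIn J B a : ℝ) < v then 1 else 0) ≤ J.card / u ^ 2 := by
  refine le_trans (cycleExp_mono hlam h0 fun a => ?_) (cycleExp_dev_le hlam h0 J B hu)
  split_ifs with h1 h2 h2
  · exact le_rfl
  · exact absurd (by rw [le_abs]; right; linarith) h2
  · exact zero_le_one
  · exact le_rfl

lemma demand_eq_countIn (a : CycleArrivals M T) :
    demand a = countIn Finset.univ (Finset.univ.erase none) a := by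
  simp [demand, countIn, arrivals, Option.isSome_iff_ne_none]

lemma arrivalsBefore_eq_countIn (a : CycleArrivals M T) (n : ℕ) :
    arrivalsBefore a n
      = countIn (Finset.univ.filter fun t => t.val < n) (Finset.univ.erase none) a := by
  unfold arrivalsBefore countIn arrivals
  congr 1
  ext t
  simp [Option.isSome_iff_ne_none, and_comm]

lemma sum_arrivalProb_some (lam : Fin M → ℝ) :
    ∑ x ∈ Finset.univ.erase none, arrivalProb lam x = ∑ j, lam j := by
  have h := Finset.add_sum_erase Finset.univ (arrivalProb lam) (Finset.mem_univ none)
  rw [sum_arrivalProb] at h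
  change 1 - ∑ j, lam j + _ = 1 at h
  linarith

lemma card_filter_val_lt {n : ℕ} (hn : n ≤ T) :
    (Finset.univ.filter fun t : Fin T => t.val < n).card = n := by
  rw [Fin.card_filter_val_lt]
  omega

/-- Follows from the variance bound through `y ≤ y ^ 2 / (2 √T) + √T / 2`. -/
lemma cycleExp_abs_demand_sub_le (hlam : ∀ j, 0 ≤ lam j) (h0 : 0 < 1 - ∑ j, lam j) (hT : 0 < T) :
    cycleExp lam (fun a : CycleArrivals M T => |(demand a : ℝ) - T * ∑ j, lam j|) ≤ √T := by
  have hs : 0 < √(T : ℝ) := Real.sqrt_pos.2 (by exact_mod_cast hT)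
  have hss : √(T : ℝ) * √T = T := Real.mul_self_sqrt (Nat.cast_nonneg T)
  have h := cycleExp_countIn_sq_le (T := T) hlam h0 Finset.univ (Finset.univ.erase none)
  simp only [← demand_eq_countIn, sum_arrivalProb_some, Finset.card_univ, Fintype.card_fin] at h
  have h2 : cycleExp lam (fun a : CycleArrivals M T => |(demand a : ℝ) - T * ∑ j, lam j|)
      ≤ cycleExp lam (fun a : CycleArrivals M T =>
        (1 / (2 * √T)) * ((demand a : ℝ) - T * ∑ j, lam j) ^ 2 + √T / 2) := by
    refine cycleExp_mono hlam h0 fun a => ?_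
    rw [← sq_abs ((demand a : ℝ) - _)]
    set y := |(demand a : ℝ) - T * ∑ j, lam j|
    have : 1 / (2 * √T) * y ^ 2 + √T / 2 - y = (1 / (2 * √T)) * (y - √T) ^ 2 := by
      field_simp
      ring
    have h3 : 0 ≤ (1 / (2 * √T)) * (y - √T) ^ 2 := by positivity
    linarith
  rw [cycleExp_add, cycleExp_const_mul, cycleExp_const] at h2
  have h3 : 1 / (2 * √T) * cycleExp lam (fun a : CycleArrivals M T =>
      ((demand a : ℝ) - T * ∑ j, lam j) ^ 2) ≤ 1 / (2 * √T) * T :=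
    mul_le_mul_of_nonneg_left h (by positivity)
  have h4 : 1 / (2 * √(T : ℝ)) * T = √T / 2 := by
    rw [one_div_mul_eq_div, div_eq_div_iff (by positivity) two_ne_zero]
    linear_combination (-2) * hss
  linarith

lemma cycleExp_demand_lt_le (hlam : ∀ j, 0 ≤ lam j) (h0 : 0 < 1 - ∑ j, lam j) {u : ℝ}
    (hu : 0 < u) :
    cycleExp lam (fun a : CycleArrivals M T =>
      if (demand a : ℝ) < T * (∑ j, lam j) - u then 1 else 0) ≤ T / u ^ 2 := by
  have h := cycleExp_countIn_lt_le (T := T) hlam h0 Finset.univ (Finset.univ.erase none)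
    (u := u) (v := T * (∑ j, lam j) - u) hu (by simp [arrivalProb])
  simpa [← demand_eq_countIn] using h

end Count

/-! ### The expected advantage in one cycle. -/

/-- The expected advantage of the offline rule in a cycle that starts with inventory `I`. -/
noncomputable def gapMean {M : ℕ} (r lam : Fin M → ℝ) (T I : ℕ) : ℝ :=
  cycleExp lam fun a : CycleArrivals M T => rewardGap r I a

/-- The exchange of `le_rewardGap` works for `k` customers unless one of three counts is too low:
type `i` among the first `t₁` periods, all customers before the last `g` periods, type `j` in the
last `g` periods. Chebyshev bounds each failure, and the gap is nonnegative on the failure event. -/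
lemma le_gapMean {M T : ℕ} {r lam : Fin M → ℝ} (hr : StrictMono r) (hr0 : ∀ j, 0 < r j)
    (hlam : ∀ j, 0 ≤ lam j) (h0 : 0 < 1 - ∑ j, lam j) {i j : Fin M} (hij : i < j)
    {I t₁ g k : ℕ} (ht₁ : t₁ ≤ I) (ht₁T : t₁ ≤ T) (hg : g ≤ T) {u₁ u₂ u₃ : ℝ}
    (hu₁ : 0 < u₁) (hu₂ : 0 < u₂) (hu₃ : 0 < u₃)
    (h₁ : k + u₁ ≤ t₁ * lam i) (h₂ : I + u₂ ≤ ((T - g : ℕ) : ℝ) * ∑ j, lam j)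
    (h₃ : k + u₃ ≤ g * lam j) :
    (r j - r i) * k * (1 - t₁ / u₁ ^ 2 - T / u₂ ^ 2 - g / u₃ ^ 2) ≤ gapMean r lam T I := by
  set J₁ := Finset.univ.filter fun t : Fin T => t.val < t₁
  set J₂ := Finset.univ.filter fun t : Fin T => t.val < T - g
  set J₃ := Finset.univ.filter fun t : Fin T => T - g ≤ t.val
  have hc₁ : J₁.card = t₁ := card_filter_val_lt ht₁T
  have hc₂ : J₂.card = T - g := card_filter_val_lt (Nat.sub_le _ _)
  have hc₃ : J₃.card = g := by
    have h := Finset.card_filter_add_card_filter_not (s := (Finset.univ : Finset (Fin T)))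
      (fun t : Fin T => t.val < T - g)
    simp only [not_lt, Finset.card_univ, Fintype.card_fin] at h
    change J₂.card + J₃.card = T at h
    omega
  have e₁ := cycleExp_countIn_lt_le (lam := lam) hlam h0 J₁ {some i} (v := k) hu₁
    (by simpa [hc₁, arrivalProb] using h₁)
  have e₂ := cycleExp_countIn_lt_le (lam := lam) hlam h0 J₂ (Finset.univ.erase none) (v := I) hu₂
    (by simpa [hc₂, arrivalProb] using h₂)
  have e₃ := cycleExp_countIn_lt_le (lam := lam) hlam h0 J₃ {some j} (v := k) hu₃
    (by simpa [hc₃, arrivalProb] using h₃)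
  rw [hc₁] at e₁
  rw [hc₂] at e₂
  rw [hc₃] at e₃
  have e₂' : (((T - g : ℕ) : ℝ)) / u₂ ^ 2 ≤ T / u₂ ^ 2 := by
    gcongr
    exact Nat.sub_le _ _
  have hc : 0 ≤ (r j - r i) * k :=
    mul_nonneg (sub_nonneg.2 (hr hij).le) (Nat.cast_nonneg _)
  have hp : ∀ a : CycleArrivals M T, (r j - r i) * k * (1
      - (if (countIn J₁ {some i} a : ℝ) < k then 1 else 0)
      - (if (countIn J₂ (Finset.univ.erase none) a : ℝ) < I then 1 else 0)
      - (if (countIn J₃ {some j} a : ℝ) < k then 1 else 0)) ≤ rewardGap r I a := by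
    intro a
    by_cases hall : k ≤ countIn J₁ {some i} a ∧ I ≤ countIn J₂ (Finset.univ.erase none) a ∧
        k ≤ countIn J₃ {some j} a
    · obtain ⟨a₁, a₂, a₃⟩ := hall
      rw [if_neg (by exact_mod_cast a₁.not_gt), if_neg (by exact_mod_cast a₂.not_gt),
        if_neg (by exact_mod_cast a₃.not_gt)]
      simp only [sub_zero, mul_one]
      refine le_rewardGap hr hr0 ht₁ (t₂ := T - g) ?_ ?_ ?_
      · rwa [arrivalsBefore_eq_countIn]
      · simpa [countIn, J₁, Finset.filter_filter] using a₁
      · simpa [countIn, J₃, Finset.filter_filter] using a₃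
    · refine le_trans (mul_nonpos_of_nonneg_of_nonpos hc ?_) (rewardGap_nonneg hr hr0 I a)
      simp only [not_and_or, not_le] at hall
      have hn : ∀ p : Prop, ∀ [Decidable p], (0 : ℝ) ≤ if p then 1 else 0 := fun p _ => by
        split_ifs <;> norm_num
      have n₁ := hn ((countIn J₁ {some i} a : ℝ) < k)
      have n₂ := hn ((countIn J₂ (Finset.univ.erase none) a : ℝ) < I)
      have n₃ := hn ((countIn J₃ {some j} a : ℝ) < k)
      rcases hall with h | h | h
      · rw [if_pos (by exact_mod_cast h : (countIn J₁ {some i} a : ℝ) < k)]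
        linarith
      · rw [if_pos (by exact_mod_cast h : (countIn J₂ (Finset.univ.erase none) a : ℝ) < I)]
        linarith
      · rw [if_pos (by exact_mod_cast h : (countIn J₃ {some j} a : ℝ) < k)]
        linarith
  have hE := cycleExp_mono hlam h0 hp
  rw [cycleExp_const_mul, cycleExp_sub, cycleExp_sub, cycleExp_sub, cycleExp_const] at hE
  exact le_trans (mul_le_mul_of_nonneg_left (by linarith) hc) hE

lemma gapMean_nonneg {M T : ℕ} {r lam : Fin M → ℝ} (hr : StrictMono r) (hr0 : ∀ j, 0 < r j)
    (hlam : ∀ j, 0 ≤ lam j) (h0 : 0 < 1 - ∑ j, lam j) (I : ℕ) : 0 ≤ gapMean r lam T I :=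
  cycleExp_nonneg hlam h0 fun a => rewardGap_nonneg hr hr0 I a

/-! ### Binomial demand: exponentially small lower tails. -/

section Binomial

variable {M T : ℕ} {lam : Fin M → ℝ}

/-- The demand of a cycle is binomially distributed. -/
lemma cycleExp_demand_eq (lam : Fin M → ℝ) (k : ℕ) :
    cycleExp lam (fun a : CycleArrivals M T => if demand a = k then 1 else 0)
      = T.choose k * (∑ j, lam j) ^ k * (1 - ∑ j, lam j) ^ (T - k) := by
  open Polynomial in
  set p := ∑ j, lam j with hp
  -- The probability generating function factorizes over the periods; the claim is its `k`-th
  -- coefficient.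
  have h1 : ∑ a : CycleArrivals M T, C (cycleProb lam a) * (X : ℝ[X]) ^ demand a
      = (C p * X + C (1 - p)) ^ T := by
    have : ∀ a : CycleArrivals M T, C (cycleProb lam a) * (X : ℝ[X]) ^ demand a
        = ∏ t, (C (arrivalProb lam (a t)) * if (a t).isSome then X else 1) := by
      intro a
      rw [Finset.prod_mul_distrib, ← map_prod, Finset.prod_ite, Finset.prod_const,
        Finset.prod_const_one, mul_one]
      rfl
    simp only [this]
    have h2 := Finset.prod_univ_sum (fun _ : Fin T => (Finset.univ : Finset (Option (Fin M))))
      fun _ x => (C (arrivalProb lam x) * if x.isSome then (X : ℝ[X]) else 1)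
    rw [Fintype.piFinset_univ] at h2
    rw [← h2, Finset.prod_const, Finset.card_univ, Fintype.card_fin, Fintype.sum_option]
    congr 1
    simp only [Option.isSome_some, Option.isSome_none, arrivalProb, if_true, ← Finset.sum_mul,
      ← map_sum, ← hp]
    simp
    ring
  have h3 := congrArg (fun q => Polynomial.coeff q k) h1
  simp only [Polynomial.finsetSum_coeff, Polynomial.coeff_C_mul, Polynomial.coeff_X_pow] at h3
  have h4 : ∀ m ∈ Finset.range (T + 1), (C p * X : ℝ[X]) ^ m * C (1 - p) ^ (T - m) * (T.choose m : ℝ[X])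
      = C (T.choose m * p ^ m * (1 - p) ^ (T - m)) * X ^ m := by
    intro m _
    simp only [map_mul, map_pow, map_natCast]
    ring
  rw [add_pow, Finset.sum_congr rfl h4] at h3
  simp only [Polynomial.finsetSum_coeff, Polynomial.coeff_C_mul, Polynomial.coeff_X_pow] at h3
  unfold cycleExp
  simp only [eq_comm (a := k)] at h3
  rw [h3]
  simp only [mul_ite, mul_one, mul_zero, Finset.sum_ite_eq', Finset.mem_range]
  split_ifs with hk
  · rfl
  · rw [Nat.choose_eq_zero_of_lt (by omega)]
    simp

lemma cycleExp_demand_eq_pos (h0 : 0 < 1 - ∑ j, lam j) (hp : 0 < ∑ j, lam j) {k : ℕ}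
    (hk : k ≤ T) :
    0 < cycleExp lam (fun a : CycleArrivals M T => if demand a = k then 1 else 0) := by
  have := Nat.choose_pos hk
  rw [cycleExp_demand_eq]
  positivity

/-- The ratio of consecutive binomial weights, `(T - k) p / ((k + 1) (1 - p))`, is at least `2` up
to half of the mean. -/
lemma two_mul_cycleExp_demand_eq_le (h0 : 0 < 1 - ∑ j, lam j) (hp : 0 < ∑ j, lam j) {k : ℕ}
    (hk : ((k + 1 : ℕ) : ℝ) ≤ T * (∑ j, lam j) / 2) :
    2 * cycleExp lam (fun a : CycleArrivals M T => if demand a = k then 1 else 0)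
      ≤ cycleExp lam (fun a : CycleArrivals M T => if demand a = k + 1 then 1 else 0) := by
  rw [cycleExp_demand_eq, cycleExp_demand_eq]
  set p := ∑ j, lam j with hpdef
  have hkT' : ((k + 1 : ℕ) : ℝ) ≤ T := by nlinarith [(Nat.cast_nonneg T : (0 : ℝ) ≤ T)]
  have hkT : k + 1 ≤ T := by exact_mod_cast hkT'
  obtain ⟨m, hm⟩ : ∃ m, T = k + 1 + m := ⟨T - (k + 1), by omega⟩
  have hc : (T.choose (k + 1) : ℝ) * (k + 1) = T.choose k * (m + 1) := by
    have := Nat.choose_succ_right_eq T k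
    rw [show T - k = m + 1 by omega] at this
    exact_mod_cast this
  rw [show T - k = m + 1 by omega, show T - (k + 1) = m by omega, pow_succ, pow_succ]
  have hTm : (T : ℝ) = k + 1 + m := by rw [hm]; push_cast; ring
  push_cast at hk
  have hineq : 2 * (1 - p) * (k + 1) ≤ (m + 1) * p := by
    nlinarith [(Nat.cast_nonneg T : (0 : ℝ) ≤ T), mul_pos hp h0,
      mul_nonneg (mul_nonneg hp.le hp.le) (Nat.cast_nonneg T : (0 : ℝ) ≤ T)]
  have hq : 0 < p ^ k * (1 - p) ^ m := by positivity
  have hk1 : (0 : ℝ) < k + 1 := by positivity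
  have hmain : 2 * (T.choose k : ℝ) * (1 - p) ≤ T.choose (k + 1) * p := by
    refine le_of_mul_le_mul_right ?_ hk1
    calc 2 * (T.choose k : ℝ) * (1 - p) * (k + 1) = T.choose k * (2 * (1 - p) * (k + 1)) := by ring
      _ ≤ T.choose k * ((m + 1) * p) := mul_le_mul_of_nonneg_left hineq (Nat.cast_nonneg _)
      _ = T.choose (k + 1) * p * (k + 1) := by linear_combination (-p) * hc
  calc 2 * ((T.choose k : ℝ) * p ^ k * ((1 - p) ^ m * (1 - p)))
      = 2 * (T.choose k : ℝ) * (1 - p) * (p ^ k * (1 - p) ^ m) := by ring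
    _ ≤ T.choose (k + 1) * p * (p ^ k * (1 - p) ^ m) := mul_le_mul_of_nonneg_right hmain hq.le
    _ = _ := by ring

/-- Small demands are exponentially less likely than demands near half of the mean. -/
lemma two_pow_mul_cycleExp_demand_lt_le (hlam : ∀ j, 0 ≤ lam j) (h0 : 0 < 1 - ∑ j, lam j)
    (hp : 0 < ∑ j, lam j)
    {θ n : ℕ} (hn : ((θ + n : ℕ) : ℝ) ≤ T * (∑ j, lam j) / 2) :
    2 ^ n * cycleExp lam (fun a : CycleArrivals M T => if demand a < θ then 1 else 0)
      ≤ cycleExp lam (fun a : CycleArrivals M T => if demand a = θ + n then 1 else 0) := by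
  induction n with
  | zero =>
    -- Doubling also controls the whole tail: if the mass below `θ` is at most that at `θ`, the mass
    -- below `θ + 1` is at most twice that at `θ`, hence at most that at `θ + 1`.
    induction θ with
    | zero =>
      simp only [not_lt_zero, if_false, cycleExp_const, mul_zero]
      exact cycleExp_nonneg hlam h0 fun a => by split_ifs <;> norm_num
    | succ θ ih =>
      have h1 := ih (by push_cast at hn ⊢; linarith)
      have h2 := two_mul_cycleExp_demand_eq_le (T := T) h0 hp (k := θ) hn
      have h3 : cycleExp lam (fun a : CycleArrivals M T => if demand a < θ + 1 then 1 else 0)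
          = cycleExp lam (fun a : CycleArrivals M T => if demand a < θ then 1 else 0)
            + cycleExp lam (fun a : CycleArrivals M T => if demand a = θ then 1 else 0) := by
        rw [← cycleExp_add]
        congr 1
        ext a
        split_ifs <;> first | omega | norm_num
      simp only [pow_zero, one_mul, add_zero] at h1 ⊢
      rw [h3]
      linarith
  | succ n ih =>
    have h1 := ih (by push_cast at hn ⊢; linarith)
    have h2 := two_mul_cycleExp_demand_eq_le (T := T) h0 hp (k := θ + n) hn
    rw [pow_succ, ← add_assoc]
    linarith

end Binomial

/-! ### The state process and its conservation laws. -/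

/-- The state after one cycle with arrivals `a`, when all demand is served as long as there is
stock. -/
def step {M T L : ℕ} [NeZero L] (S : ℕ) (s : SystemState L) (a : CycleArrivals M T) :
    SystemState L := nextState S s (s.onHand - demand a)

/-- The states along the arrivals `H` under the base-stock policy with level `S`. -/
def trajectory {M T L : ℕ} [NeZero L] (S : ℕ) (s₀ : SystemState L)
    (H : ℕ → CycleArrivals M T) : ℕ → SystemState L
  | 0 => s₀
  | n + 1 => step S (trajectory S s₀ H n) (H n)

/-- The transition operator of the state process. -/
noncomputable def evolve {M L : ℕ} [NeZero L] (lam : Fin M → ℝ) (T S : ℕ)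
    (F : SystemState L → ℝ) (s : SystemState L) : ℝ :=
  cycleExp lam fun a : CycleArrivals M T => F (step S s a)

section Slots

variable {M T L : ℕ} [NeZero L]

/-- A general `g` is needed: the identity gives the inventory position, `fun n => θ - n` the
shortfall. -/
lemma sum_outstanding_comp {A : Type*} [AddCommMonoid A] (g : ℕ → A) (S : ℕ)
    (s : SystemState L) :
    ∑ i, g (outstanding S s i) = ∑ i, g (s.orders i) + g (newOrder S s) := by
  obtain ⟨l, rfl⟩ : ∃ l, L = l + 1 := ⟨L - 1, (Nat.succ_pred_eq_of_pos (NeZero.pos L)).symm⟩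
  rw [Fin.sum_univ_castSucc]
  congr 1
  · exact Finset.sum_congr rfl fun i _ => by
      have : i.val < l + 1 - 1 := i.isLt
      simp [outstanding]
  · simp [outstanding]

lemma sum_outstanding_eq_head_add {A : Type*} [AddCommMonoid A] (g : ℕ → A) (S : ℕ)
    (s : SystemState L) (ℓ : ℕ) :
    ∑ i, g (outstanding S s i) = g (outstanding S s 0) + ∑ i, g ((nextState S s ℓ).orders i) := by
  obtain ⟨l, rfl⟩ : ∃ l, L = l + 1 := ⟨L - 1, (Nat.succ_pred_eq_of_pos (NeZero.pos L)).symm⟩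
  rw [Fin.sum_univ_succ]
  rfl

lemma onHand_add_sum_outstanding {S : ℕ} {s : SystemState L} (hs : s.position ≤ S) :
    s.onHand + ∑ i, outstanding S s i = S := by
  have := sum_outstanding_comp (fun n => n) S s
  rw [this]
  unfold newOrder SystemState.position at *
  omega

lemma position_nextState {S : ℕ} {s : SystemState L} (hs : s.position ≤ S) {ℓ : ℕ}
    (hℓ : ℓ ≤ s.onHand) : (nextState S s ℓ).position = S - (s.onHand - ℓ) := by
  have h1 := sum_outstanding_eq_head_add (fun n => n) S s ℓ
  have h2 := onHand_add_sum_outstanding hs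
  have h3 : (nextState S s ℓ).onHand = ℓ + outstanding S s 0 := rfl
  unfold SystemState.position
  omega

lemma position_step_le {S : ℕ} {s : SystemState L} (hs : s.position ≤ S)
    (a : CycleArrivals M T) : (step S s a).position ≤ S := by
  rw [step, position_nextState hs (Nat.sub_le _ _)]
  exact Nat.sub_le _ _

/-- After the first order the position is restored every cycle, so each order replaces exactly the
last sales. -/
lemma newOrder_step {S : ℕ} {s : SystemState L} (hs : s.position ≤ S) (a : CycleArrivals M T) :
    newOrder S (step S s a) = min s.onHand (demand a) := by
  have h2 := onHand_add_sum_outstanding hs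
  rw [newOrder, step, position_nextState hs (Nat.sub_le _ _)]
  omega

/-- The pipeline shifts by one: its head arrives and the sales of the cycle enter at the end. -/
lemma sum_outstanding_step {A : Type*} [AddCommMonoid A] (g : ℕ → A) {S : ℕ} {s : SystemState L}
    (hs : s.position ≤ S) (a : CycleArrivals M T) :
    ∑ i, g (outstanding S (step S s a) i) + g (outstanding S s 0)
      = ∑ i, g (outstanding S s i) + g (min s.onHand (demand a)) := by
  rw [sum_outstanding_comp, newOrder_step hs,
    sum_outstanding_eq_head_add g S s (s.onHand - demand a)]
  simp only [step]
  abel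

lemma onHand_step (S : ℕ) (s : SystemState L) (a : CycleArrivals M T) :
    (step S s a).onHand = s.onHand - demand a + outstanding S s 0 := rfl

lemma position_trajectory_le {S : ℕ} {s : SystemState L} (hs : s.position ≤ S)
    (H : ℕ → CycleArrivals M T) (n : ℕ) : (trajectory S s H n).position ≤ S := by
  induction n with
  | zero => exact hs
  | succ n ih => exact position_step_le ih _

lemma trajectory_succ' (S : ℕ) (s : SystemState L) (H : ℕ → CycleArrivals M T) (n : ℕ) :
    trajectory S s H (n + 1) = trajectory S (step S s (H 0)) (fun k => H (k + 1)) n := by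
  induction n with
  | zero => rfl
  | succ n ih => rw [trajectory, ih]; rfl

lemma stateAt_eq_trajectory {rule : FulfillmentRule M T}
    (hrule : ∀ I a, stockBefore rule I a T = I - demand a) (S : ℕ) (s : SystemState L)
    (H : ℕ → CycleArrivals M T) (n : ℕ) : stateAt rule S s H n = trajectory S s H n := by
  induction n with
  | zero => rfl
  | succ n ih => rw [stateAt, trajectory, hrule, ih]; rfl

lemma finite_position_le (L S : ℕ) : {s : SystemState L | s.position ≤ S}.Finite := by
  refine (((Set.finite_Iic S).prod (Set.Finite.pi' fun _ : Fin (L - 1) => Set.finite_Iic S)).image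
    fun x => (⟨x.1, x.2⟩ : SystemState L)).subset fun s hs => ?_
  refine ⟨(s.onHand, s.orders), ⟨?_, fun i => ?_⟩, rfl⟩
  · exact (Nat.le_add_right _ _).trans hs
  · exact (Finset.single_le_sum (f := s.orders) (fun _ _ => Nat.zero_le _)
      (Finset.mem_univ i)).trans ((Nat.le_add_left _ _).trans hs)

end Slots

/-! ### From sums over demand paths to the transition operator. -/

section Path

variable {M T L : ℕ} [NeZero L] {lam : Fin M → ℝ}

lemma extendPath_cons {N : ℕ} (a : CycleArrivals M T) (H : Fin N → CycleArrivals M T) :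
    extendPath (Fin.cons a H : Fin (N + 1) → CycleArrivals M T) 0 = a ∧
      (fun k => extendPath (Fin.cons a H : Fin (N + 1) → CycleArrivals M T) (k + 1))
        = extendPath H := by
  refine ⟨rfl, funext fun k => ?_⟩
  by_cases hk : k < N
  · have : (⟨k + 1, by omega⟩ : Fin (N + 1)) = Fin.succ ⟨k, hk⟩ := rfl
    rw [extendPath, dif_pos (by omega : k + 1 < N + 1), this, Fin.cons_succ, extendPath,
      dif_pos hk]
  · simp [extendPath, hk]

lemma sum_path_succ {N : ℕ} (F : (Fin (N + 1) → CycleArrivals M T) → ℝ) :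
    ∑ H : Fin (N + 1) → CycleArrivals M T, pathProb lam H * F H
      = cycleExp lam fun a : CycleArrivals M T =>
          ∑ H : Fin N → CycleArrivals M T, pathProb lam H * F (Fin.cons a H) := by
  rw [← (Fin.consEquiv fun _ : Fin (N + 1) => CycleArrivals M T).sum_comp, Fintype.sum_prod_type]
  refine Finset.sum_congr rfl fun a _ => ?_
  rw [Finset.mul_sum]
  refine Finset.sum_congr rfl fun H _ => ?_
  have : pathProb lam (Fin.cons a H : Fin (N + 1) → CycleArrivals M T)
      = cycleProb lam a * pathProb lam H := by
    simp [pathProb, cycleProb, Fin.prod_univ_succ]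
  simp only [Fin.consEquiv, Equiv.coe_fn_mk]
  rw [this, mul_assoc]

lemma sum_pathProb (lam : Fin M → ℝ) (T N : ℕ) :
    ∑ H : Fin N → CycleArrivals M T, pathProb lam H = 1 := by
  induction N with
  | zero => simp [pathProb]
  | succ N ih =>
    have h := sum_path_succ (lam := lam) (T := T) (N := N) fun _ => 1
    simp only [mul_one] at h
    rw [h]
    simp only [ih, cycleExp_const]

lemma pathProb_nonneg (hlam : ∀ j, 0 ≤ lam j) (h0 : 0 < 1 - ∑ j, lam j) {N : ℕ}
    (H : Fin N → CycleArrivals M T) : 0 ≤ pathProb lam H :=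
  Finset.prod_nonneg fun n _ => cycleProb_nonneg hlam h0 (H n)

/-- The Markov property, by conditioning on the first cycle. The induction shifts time, hence the
dependence of `φ` on `n`. -/
lemma sum_path_trajectory (S N : ℕ) (φ : ℕ → SystemState L → CycleArrivals M T → ℝ)
    (s : SystemState L) :
    ∑ H : Fin N → CycleArrivals M T, pathProb lam H *
        ∑ n : Fin N, φ n (trajectory S s (extendPath H) n) (H n)
      = ∑ n ∈ Finset.range N, (evolve lam T S)^[n] (fun s => cycleExp lam (φ n s)) s := by
  induction N generalizing φ s with
  | zero => simp
  | succ N ih =>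
    have hstep : ∀ a : CycleArrivals M T, ∑ H : Fin N → CycleArrivals M T, pathProb lam H *
        ∑ n : Fin (N + 1), φ n (trajectory S s (extendPath (Fin.cons a H)) n)
          ((Fin.cons a H : Fin (N + 1) → CycleArrivals M T) n)
        = φ 0 s a + ∑ n ∈ Finset.range N, (evolve lam T S)^[n]
            (fun s => cycleExp lam (φ (n + 1) s)) (step S s a) := by
      intro a
      rw [← ih fun n => φ (n + 1), ← one_mul (φ 0 s a), ← sum_pathProb lam T N, Finset.sum_mul,
        ← Finset.sum_add_distrib]
      refine Finset.sum_congr rfl fun H _ => ?_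
      rw [Fin.sum_univ_succ, mul_add]
      simp only [Fin.cons_zero, Fin.cons_succ, Fin.val_zero, Fin.val_succ, trajectory_succ',
        (extendPath_cons a H).1, (extendPath_cons a H).2]
      rfl
    rw [sum_path_succ, Finset.sum_range_succ', add_comm (∑ k ∈ Finset.range N, _)]
    simp only [hstep, Function.iterate_succ_apply']
    rw [cycleExp_add, cycleExp_sum]
    rfl

/-- A bound that holds along every path of `N` cycles holds in expectation. -/
lemma le_sum_evolve (hlam : ∀ j, 0 ≤ lam j) (h0 : 0 < 1 - ∑ j, lam j) {S N : ℕ}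
    {φ : ℕ → SystemState L → CycleArrivals M T → ℝ} {s : SystemState L} {c : ℝ}
    (h : ∀ H : ℕ → CycleArrivals M T,
      c ≤ ∑ n ∈ Finset.range N, φ n (trajectory S s H n) (H n)) :
    c ≤ ∑ n ∈ Finset.range N, (evolve lam T S)^[n] (fun s => cycleExp lam (φ n s)) s := by
  rw [← sum_path_trajectory, ← one_mul c, ← sum_pathProb lam T N, Finset.sum_mul]
  refine Finset.sum_le_sum fun H _ => mul_le_mul_of_nonneg_left ?_ (pathProb_nonneg hlam h0 H)
  refine (h (extendPath H)).trans_eq ?_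
  rw [Finset.sum_range]
  exact Finset.sum_congr rfl fun n _ => by simp [extendPath]

lemma avgProfit_eq {rule : FulfillmentRule M T}
    (hrule : ∀ I a, stockBefore rule I a T = I - demand a) (r : Fin M → ℝ) (h : ℝ) (S : ℕ)
    (s : SystemState L) (N : ℕ) :
    avgProfit r lam h rule S s N = (N : ℝ)⁻¹ * ∑ n ∈ Finset.range N, (evolve lam T S)^[n]
      (fun s => cycleExp lam (cycleProfit r h rule s.onHand)) s := by
  rw [avgProfit, one_div]
  simp only [stateAt_eq_trajectory hrule]
  rw [sum_path_trajectory S N fun _ s a => cycleProfit r h rule s.onHand a]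

end Path

/-! ### Ergodicity and stationary means. -/

section Ergodic

variable {M T S L : ℕ} [NeZero L] {lam : Fin M → ℝ}

lemma evolve_mono (hlam : ∀ j, 0 ≤ lam j) (h0 : 0 < 1 - ∑ j, lam j) {F G : SystemState L → ℝ}
    (h : ∀ s, s.position ≤ S → F s ≤ G s) (s : SystemState L) (hs : s.position ≤ S) :
    evolve lam T S F s ≤ evolve lam T S G s :=
  cycleExp_mono hlam h0 fun a => h _ (position_step_le hs a)

lemma evolve_const (c : ℝ) : evolve lam T S (fun _ : SystemState L => c) = fun _ => c :=
  funext fun _ => cycleExp_const c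

lemma evolve_add (F G : SystemState L → ℝ) :
    evolve lam T S (fun s => F s + G s) = fun s => evolve lam T S F s + evolve lam T S G s :=
  funext fun _ => cycleExp_add _ _

lemma evolve_const_mul (c : ℝ) (F : SystemState L → ℝ) :
    evolve lam T S (fun s => c * F s) = fun s => c * evolve lam T S F s :=
  funext fun _ => cycleExp_const_mul _ _

lemma evolve_iterate_mono (hlam : ∀ j, 0 ≤ lam j) (h0 : 0 < 1 - ∑ j, lam j)
    {F G : SystemState L → ℝ} (h : ∀ s, s.position ≤ S → F s ≤ G s) (n : ℕ) (s : SystemState L)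
    (hs : s.position ≤ S) : (evolve lam T S)^[n] F s ≤ (evolve lam T S)^[n] G s := by
  induction n generalizing s with
  | zero => exact h s hs
  | succ n ih =>
    rw [Function.iterate_succ_apply', Function.iterate_succ_apply']
    exact evolve_mono hlam h0 ih s hs

lemma evolve_iterate_const (c : ℝ) (n : ℕ) :
    (evolve lam T S)^[n] (fun _ : SystemState L => c) = fun _ => c := by
  induction n with
  | zero => rfl
  | succ n ih => rw [Function.iterate_succ_apply', ih, evolve_const]

lemma evolve_iterate_add (F G : SystemState L → ℝ) (n : ℕ) :
    (evolve lam T S)^[n] (fun s => F s + G s)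
      = fun s => (evolve lam T S)^[n] F s + (evolve lam T S)^[n] G s := by
  induction n with
  | zero => rfl
  | succ n ih => rw [Function.iterate_succ_apply', ih, evolve_add]
                 simp only [Function.iterate_succ_apply']

lemma evolve_iterate_const_mul (c : ℝ) (F : SystemState L → ℝ) (n : ℕ) :
    (evolve lam T S)^[n] (fun s => c * F s) = fun s => c * (evolve lam T S)^[n] F s := by
  induction n with
  | zero => rfl
  | succ n ih => rw [Function.iterate_succ_apply', ih, evolve_const_mul]
                 simp only [Function.iterate_succ_apply']

/-- The state with all inventory on hand. -/
def fullState (L S : ℕ) : SystemState L := ⟨S, fun _ => 0⟩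

lemma position_fullState_le (L S : ℕ) : (fullState L S).position ≤ S := by
  simp [fullState, SystemState.position]

/-- The state after `n` cycles without customers. -/
def idle (S : ℕ) (s : SystemState L) (n : ℕ) : SystemState L :=
  (fun s => nextState S s s.onHand)^[n] s

/-- Without sales only the first order can be nonzero, and it has arrived after `L` cycles. This
gives one state reachable from everywhere in the same time. -/
lemma idle_eq_fullState {s : SystemState L} (hs : s.position ≤ S) : idle S s L = fullState L S := by
  have key : ∀ k, (idle S s (k + 1)).position = S ∧
      ∀ i : Fin (L - 1), L ≤ i.val + (k + 1) → (idle S s (k + 1)).orders i = 0 := by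
    intro k
    induction k with
    | zero =>
      refine ⟨?_, fun i hi => absurd i.isLt (by omega)⟩
      exact (position_nextState hs le_rfl).trans (by simp)
    | succ k ih =>
      have hsucc : idle S s (k + 1 + 1)
          = nextState S (idle S s (k + 1)) (idle S s (k + 1)).onHand :=
        Function.iterate_succ_apply' _ _ _
      rw [hsucc]
      refine ⟨(position_nextState ih.1.le le_rfl).trans (by simp), fun i hi => ?_⟩
      simp only [nextState, outstanding]
      split_ifs with h
      · exact ih.2 _ (by simp only; omega)
      · simp [newOrder, ih.1]
  obtain ⟨l, hl⟩ : ∃ l, L = l + 1 := ⟨L - 1, (Nat.succ_pred_eq_of_pos (NeZero.pos L)).symm⟩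
  have h := key l
  rw [← hl] at h
  have ho : (idle S s L).orders = fun _ => 0 := funext fun i => h.2 i (by omega)
  have hh : (idle S s L).onHand = S := by
    have := h.1
    simpa [SystemState.position, ho] using this
  rw [fullState]
  cases hI : idle S s L
  simp_all

lemma position_idle_le {s : SystemState L} (hs : s.position ≤ S) (n : ℕ) :
    (idle S s n).position ≤ S := by
  induction n with
  | zero => exact hs
  | succ n ih =>
    have hsucc : idle S s (n + 1) = nextState S (idle S s n) (idle S s n).onHand :=
      Function.iterate_succ_apply' _ _ _
    rw [hsucc, position_nextState ih le_rfl]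
    simp

lemma mul_le_evolve (hlam : ∀ j, 0 ≤ lam j) (h0 : 0 < 1 - ∑ j, lam j) {K : SystemState L → ℝ}
    (hK : ∀ s, s.position ≤ S → 0 ≤ K s) {s : SystemState L} (hs : s.position ≤ S) :
    (1 - ∑ j, lam j) ^ T * K (nextState S s s.onHand) ≤ evolve lam T S K s := by
  have h := Finset.single_le_sum (f := fun a : CycleArrivals M T => cycleProb lam a *
    K (step S s a)) (fun a _ => mul_nonneg (cycleProb_nonneg hlam h0 a)
      (hK _ (position_step_le hs a))) (Finset.mem_univ fun _ => none)
  refine le_trans (le_of_eq ?_) h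
  simp [cycleProb, arrivalProb, step, demand, arrivals]

lemma mul_le_evolve_iterate (hlam : ∀ j, 0 ≤ lam j) (h0 : 0 < 1 - ∑ j, lam j)
    {K : SystemState L → ℝ} (hK : ∀ s, s.position ≤ S → 0 ≤ K s) (n : ℕ) {s : SystemState L}
    (hs : s.position ≤ S) :
    ((1 - ∑ j, lam j) ^ T) ^ n * K (idle S s n) ≤ (evolve lam T S)^[n] K s := by
  induction n generalizing s with
  | zero => simp [idle]
  | succ n ih =>
    have hK' : ∀ s, s.position ≤ S → 0 ≤ (evolve lam T S)^[n] K s := fun s hs => by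
      have := evolve_iterate_mono (T := T) hlam h0 hK n s hs
      rwa [evolve_iterate_const] at this
    have hs' : (nextState S s s.onHand).position ≤ S := position_idle_le hs 1
    rw [Function.iterate_succ_apply']
    refine le_trans ?_ (mul_le_evolve hlam h0 hK' hs)
    rw [pow_succ', mul_assoc]
    exact mul_le_mul_of_nonneg_left (ih hs') (pow_nonneg h0.le T)

/-- Doeblin contraction of the oscillation over `L` cycles. -/
lemma oscillation_contract (hlam : ∀ j, 0 ≤ lam j) (h0 : 0 < 1 - ∑ j, lam j)
    {F : SystemState L → ℝ} {c : ℝ}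
    (hF : ∀ s s' : SystemState L, s.position ≤ S → s'.position ≤ S → F s - F s' ≤ c)
    {s s' : SystemState L} (hs : s.position ≤ S) (hs' : s'.position ≤ S) :
    (evolve lam T S)^[L] F s - (evolve lam T S)^[L] F s'
      ≤ (1 - ((1 - ∑ j, lam j) ^ T) ^ L) * c := by
  set δ := ((1 - ∑ j, lam j) ^ T) ^ L
  obtain ⟨x, hx, hmax⟩ := Set.exists_max_image _ F (finite_position_le L S)
    ⟨_, position_fullState_le L S⟩
  obtain ⟨y, hy, hmin⟩ := Set.exists_min_image _ F (finite_position_le L S)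
    ⟨_, position_fullState_le L S⟩
  -- With mass at least `δ` both starts are in `fullState L S` after `L` cycles. Applied to the
  -- nonnegative functions `F x - F` and `F - F y`, the two bounds add up and the value at
  -- `fullState L S` cancels.
  have h1 := mul_le_evolve_iterate (T := T) hlam h0 (K := fun s => F x + (-1) * F s)
    (fun s hs => by have := hmax s hs; linarith) L hs
  have h2 := mul_le_evolve_iterate (T := T) hlam h0 (K := fun s => F s + (-1) * F y)
    (fun s hs => by have := hmin s hs; linarith) L hs'
  have hδ : δ ≤ 1 := by
    have h1' : 1 - ∑ j, lam j ≤ 1 := by linarith [Finset.sum_nonneg fun j (_ : j ∈ Finset.univ) => hlam j]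
    exact pow_le_one₀ (pow_nonneg h0.le T) (pow_le_one₀ h0.le h1')
  rw [evolve_iterate_add, evolve_iterate_const, evolve_iterate_const_mul, idle_eq_fullState hs] at h1
  rw [evolve_iterate_add, evolve_iterate_const, idle_eq_fullState hs'] at h2
  have h3 := mul_le_mul_of_nonneg_left (hF x y hx hy) (sub_nonneg.2 hδ)
  change δ * _ ≤ _ at h1
  change δ * _ ≤ _ at h2
  nlinarith

lemma exists_oscillation_le (hlam : ∀ j, 0 ≤ lam j) (h0 : 0 < 1 - ∑ j, lam j)
    (F : SystemState L → ℝ) {ε : ℝ} (hε : 0 < ε) :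
    ∃ n, ∀ s s' : SystemState L, s.position ≤ S → s'.position ≤ S →
      (evolve lam T S)^[n] F s - (evolve lam T S)^[n] F s' ≤ ε := by
  set δ := ((1 - ∑ j, lam j) ^ T) ^ L with hδdef
  have hδ0 : 0 < δ := by positivity
  have hδ : δ ≤ 1 := by
    have h1' : 1 - ∑ j, lam j ≤ 1 := by linarith [Finset.sum_nonneg fun j (_ : j ∈ Finset.univ) => hlam j]
    exact pow_le_one₀ (pow_nonneg h0.le T) (pow_le_one₀ h0.le h1')
  obtain ⟨x, hx, hmax⟩ := Set.exists_max_image _ F (finite_position_le L S)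
    ⟨_, position_fullState_le L S⟩
  obtain ⟨y, hy, hmin⟩ := Set.exists_min_image _ F (finite_position_le L S)
    ⟨_, position_fullState_le L S⟩
  have key : ∀ k : ℕ, ∀ s s' : SystemState L, s.position ≤ S → s'.position ≤ S →
      (evolve lam T S)^[L * k] F s - (evolve lam T S)^[L * k] F s'
        ≤ (1 - δ) ^ k * (F x - F y) := by
    intro k
    induction k with
    | zero =>
      intro s s' hs hs'
      have h1 := hmax s hs
      have h2 := hmin s' hs'
      simp only [mul_zero, Function.iterate_zero, id_eq, pow_zero, one_mul]
      linarith
    | succ k ih =>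
      intro s s' hs hs'
      have h := oscillation_contract (T := T) hlam h0 ih hs hs'
      rw [← Function.iterate_add_apply, ← mul_assoc, ← pow_succ'] at h
      rwa [mul_add, mul_one, add_comm (L * k)]
  have hlim : Tendsto (fun k : ℕ => (1 - δ) ^ k * (F x - F y)) atTop (𝓝 (0 * (F x - F y))) :=
    (tendsto_pow_atTop_nhds_zero_of_lt_one (by linarith) (by linarith)).mul_const _
  rw [zero_mul] at hlim
  obtain ⟨k, hk⟩ := (hlim.eventually (gt_mem_nhds hε)).exists
  exact ⟨L * k, fun s s' hs hs' => (key k s s' hs hs').trans hk.le⟩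

/-- Averaging never leaves the range of `F`, so a small oscillation at one time persists and makes
the iterates Cauchy. -/
lemma abs_evolve_iterate_sub_le (hlam : ∀ j, 0 ≤ lam j) (h0 : 0 < 1 - ∑ j, lam j)
    {F : SystemState L → ℝ} {c : ℝ}
    (hF : ∀ s s' : SystemState L, s.position ≤ S → s'.position ≤ S → F s - F s' ≤ c)
    (n : ℕ) {s s' : SystemState L} (hs : s.position ≤ S) (hs' : s'.position ≤ S) :
    |(evolve lam T S)^[n] F s - F s'| ≤ c := by
  have h1 := evolve_iterate_mono (T := T) hlam h0 (F := F) (G := fun _ => F s' + c)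
    (fun u hu => by linarith [hF u s' hu hs']) n s hs
  have h2 := evolve_iterate_mono (T := T) hlam h0 (F := fun _ => F s' - c) (G := F)
    (fun u hu => by linarith [hF s' u hs' hu]) n s hs
  rw [evolve_iterate_const] at h1 h2
  exact abs_sub_le_iff.2 ⟨by linarith, by linarith⟩

/-- The stationary expectation of a function of the state. -/
noncomputable def stationaryMean (lam : Fin M → ℝ) (T S : ℕ) (F : SystemState L → ℝ) : ℝ :=
  limUnder atTop fun n => (evolve lam T S)^[n] F (fullState L S)

lemma tendsto_evolve_iterate (hlam : ∀ j, 0 ≤ lam j) (h0 : 0 < 1 - ∑ j, lam j)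
    (F : SystemState L → ℝ) {s : SystemState L} (hs : s.position ≤ S) :
    Tendsto (fun n => (evolve lam T S)^[n] F s) atTop (𝓝 (stationaryMean lam T S F)) := by
  have hclose : ∀ ε > 0, ∃ n₀, ∀ s s' : SystemState L, s.position ≤ S → s'.position ≤ S →
      ∀ n ≥ n₀, |(evolve lam T S)^[n] F s - (evolve lam T S)^[n₀] F s'| ≤ ε := by
    intro ε hε
    obtain ⟨n₀, hn₀⟩ := exists_oscillation_le (T := T) (S := S) hlam h0 F hε
    refine ⟨n₀, fun s s' hs hs' n hn => ?_⟩
    have := abs_evolve_iterate_sub_le (T := T) hlam h0 hn₀ (n - n₀) hs hs'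
    rwa [← Function.iterate_add_apply, Nat.sub_add_cancel hn] at this
  have hfull := position_fullState_le L S
  have hc : CauchySeq fun n => (evolve lam T S)^[n] F (fullState L S) := by
    refine Metric.cauchySeq_iff'.2 fun ε hε => ?_
    obtain ⟨n₀, h⟩ := hclose (ε / 2) (by linarith)
    exact ⟨n₀, fun n hn => lt_of_le_of_lt (h _ _ hfull hfull n hn) (by linarith)⟩
  have hl : Tendsto (fun n => (evolve lam T S)^[n] F (fullState L S)) atTop
      (𝓝 (stationaryMean lam T S F)) := hc.tendsto_limUnder
  have hd : Tendsto (fun n => (evolve lam T S)^[n] F s - (evolve lam T S)^[n] F (fullState L S))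
      atTop (𝓝 0) := by
    refine Metric.tendsto_atTop.2 fun ε hε => ?_
    obtain ⟨n₀, h⟩ := hclose (ε / 3) (by linarith)
    refine ⟨n₀, fun n hn => ?_⟩
    have h1 := abs_sub_le_iff.1 (h s s hs hs n hn)
    have h2 := abs_sub_le_iff.1 (h (fullState L S) s hfull hs n hn)
    rw [Real.dist_eq, sub_zero]
    refine lt_of_le_of_lt (abs_sub_le_iff.2 ⟨?_, ?_⟩ : _ ≤ 2 * (ε / 3)) (by linarith)
    · linarith [h1.1, h2.2]
    · linarith [h1.2, h2.1]
  simpa using hd.add hl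

lemma stationaryMean_eq_of_tendsto (hlam : ∀ j, 0 ≤ lam j) (h0 : 0 < 1 - ∑ j, lam j)
    {F : SystemState L → ℝ} {c : ℝ}
    (h : Tendsto (fun n => (evolve lam T S)^[n] F (fullState L S)) atTop (𝓝 c)) :
    stationaryMean lam T S F = c :=
  tendsto_nhds_unique (tendsto_evolve_iterate hlam h0 F (position_fullState_le L S)) h

lemma stationaryMean_mono (hlam : ∀ j, 0 ≤ lam j) (h0 : 0 < 1 - ∑ j, lam j)
    {F G : SystemState L → ℝ} (h : ∀ s, s.position ≤ S → F s ≤ G s) :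
    stationaryMean lam T S F ≤ stationaryMean lam T S G :=
  le_of_tendsto_of_tendsto' (tendsto_evolve_iterate hlam h0 F (position_fullState_le L S))
    (tendsto_evolve_iterate hlam h0 G (position_fullState_le L S))
    fun n => evolve_iterate_mono hlam h0 h n _ (position_fullState_le L S)

lemma stationaryMean_const (hlam : ∀ j, 0 ≤ lam j) (h0 : 0 < 1 - ∑ j, lam j) (c : ℝ) :
    stationaryMean lam T S (fun _ : SystemState L => c) = c :=
  stationaryMean_eq_of_tendsto hlam h0 (by simp [evolve_iterate_const])

lemma stationaryMean_add (hlam : ∀ j, 0 ≤ lam j) (h0 : 0 < 1 - ∑ j, lam j)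
    (F G : SystemState L → ℝ) : stationaryMean lam T S (fun s => F s + G s)
      = stationaryMean lam T S F + stationaryMean lam T S G :=
  stationaryMean_eq_of_tendsto hlam h0 (by
    simp only [evolve_iterate_add]
    exact (tendsto_evolve_iterate hlam h0 F (position_fullState_le L S)).add
      (tendsto_evolve_iterate hlam h0 G (position_fullState_le L S)))

lemma stationaryMean_const_mul (hlam : ∀ j, 0 ≤ lam j) (h0 : 0 < 1 - ∑ j, lam j) (c : ℝ)
    (F : SystemState L → ℝ) :
    stationaryMean lam T S (fun s => c * F s) = c * stationaryMean lam T S F :=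
  stationaryMean_eq_of_tendsto hlam h0 (by
    simp only [evolve_iterate_const_mul]
    exact (tendsto_evolve_iterate hlam h0 F (position_fullState_le L S)).const_mul c)

lemma stationaryMean_sum (hlam : ∀ j, 0 ≤ lam j) (h0 : 0 < 1 - ∑ j, lam j) {ι : Type*}
    (A : Finset ι) (F : ι → SystemState L → ℝ) :
    stationaryMean lam T S (fun s => ∑ i ∈ A, F i s) = ∑ i ∈ A, stationaryMean lam T S (F i) := by
  classical
  induction A using Finset.induction_on with
  | empty => simp [stationaryMean_const hlam h0]
  | insert i A hi ih =>
    simp only [Finset.sum_insert hi]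
    rw [stationaryMean_add hlam h0, ih]

lemma stationaryMean_evolve_iterate (hlam : ∀ j, 0 ≤ lam j) (h0 : 0 < 1 - ∑ j, lam j)
    (F : SystemState L → ℝ) (k : ℕ) :
    stationaryMean lam T S ((evolve lam T S)^[k] F) = stationaryMean lam T S F :=
  stationaryMean_eq_of_tendsto hlam h0 (by
    simp only [← Function.iterate_add_apply]
    exact (tendsto_evolve_iterate hlam h0 F (position_fullState_le L S)).comp
      (tendsto_add_atTop_nat k))

/-- A bound that holds along every path of `N` cycles holds for the stationary expectations. -/
lemma le_sum_stationaryMean (hlam : ∀ j, 0 ≤ lam j) (h0 : 0 < 1 - ∑ j, lam j) {N : ℕ}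
    {φ : ℕ → SystemState L → CycleArrivals M T → ℝ} {c : ℝ}
    (h : ∀ s : SystemState L, s.position ≤ S → ∀ H : ℕ → CycleArrivals M T,
      c ≤ ∑ n ∈ Finset.range N, φ n (trajectory S s H n) (H n)) :
    c ≤ ∑ n ∈ Finset.range N, stationaryMean lam T S fun s => cycleExp lam (φ n s) := by
  rw [← stationaryMean_const (L := L) (T := T) (S := S) hlam h0 c]
  refine (stationaryMean_mono hlam h0 fun s hs => le_sum_evolve hlam h0 (h s hs)).trans_eq ?_
  rw [stationaryMean_sum hlam h0]
  exact Finset.sum_congr rfl fun n _ => stationaryMean_evolve_iterate hlam h0 _ n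

/-- The expected profit of cycle `n` converges, hence so do its Cesàro means, to a limit independent
of the initial state. -/
lemma tendsto_avgProfit (hlam : ∀ j, 0 ≤ lam j) (h0 : 0 < 1 - ∑ j, lam j)
    {rule : FulfillmentRule M T} (hrule : ∀ I a, stockBefore rule I a T = I - demand a)
    (r : Fin M → ℝ) (h : ℝ) {s : SystemState L} (hs : s.position ≤ S) :
    Tendsto (avgProfit r lam h rule S s) atTop (𝓝 (stationaryMean lam T S
      fun s : SystemState L => cycleExp lam (cycleProfit r h rule s.onHand))) := by
  simp only [funext (avgProfit_eq (lam := lam) hrule r h S s)]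
  exact (tendsto_evolve_iterate hlam h0 _ hs).cesaro

lemma longRunProfit_eq (hlam : ∀ j, 0 ≤ lam j) (h0 : 0 < 1 - ∑ j, lam j)
    {rule : FulfillmentRule M T} (hrule : ∀ I a, stockBefore rule I a T = I - demand a)
    (r : Fin M → ℝ) (h : ℝ) {s : SystemState L} (hs : s.position ≤ S) :
    longRunProfit r lam h rule S s = stationaryMean lam T S
      fun s : SystemState L => cycleExp lam (cycleProfit r h rule s.onHand) :=
  (tendsto_avgProfit hlam h0 hrule r h hs).limUnder_eq

end Ergodic

/-! ### Drift argument: large stocks followed by small orders are rare. -/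

section Drift

variable {M T S L : ℕ} [NeZero L] {lam : Fin M → ℝ}

/-- The total shortfall of the stocks on hand and on order below the threshold `θ`. -/
def shortfall (S θ : ℕ) (s : SystemState L) : ℕ :=
  (θ - s.onHand) + ∑ i, (θ - outstanding S s i)

/-- Sales of at least `θ`, or of the whole stock, create no new shortfall, so only a demand below
`θ` can raise the total, by at most `θ`. If the demand is exactly `m`, a stock above `m` leaves a
unit over that fills part of the shortfall of the incoming order. -/
lemma shortfall_step_le {θ m : ℕ} (hθm : θ ≤ m) {s : SystemState L} (hs : s.position ≤ S)
    (a : CycleArrivals M T) :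
    shortfall S θ (step S s a)
        + (if m < s.onHand ∧ outstanding S s 0 < θ then 1 else 0) * (if demand a = m then 1 else 0)
      ≤ shortfall S θ s + θ * (if demand a < θ then 1 else 0) := by
  have h := sum_outstanding_step (fun n => θ - n) hs a
  unfold shortfall
  rw [onHand_step]
  split_ifs <;> simp only [mul_one, mul_zero] <;> omega

/-- In stationarity, a large stock on hand is rarely followed by a small incoming order. -/
lemma stationaryMean_large_small_le (hlam : ∀ j, 0 ≤ lam j) (h0 : 0 < 1 - ∑ j, lam j)
    (hp : 0 < ∑ j, lam j) {θ n : ℕ} (hn : ((θ + n : ℕ) : ℝ) ≤ T * (∑ j, lam j) / 2) :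
    stationaryMean lam T S (fun s : SystemState L =>
      if θ + n < s.onHand ∧ outstanding S s 0 < θ then 1 else 0) ≤ θ / 2 ^ n := by
  set b : SystemState L → ℝ := fun s =>
    if θ + n < s.onHand ∧ outstanding S s 0 < θ then 1 else 0 with hb
  set pe := cycleExp lam (fun a : CycleArrivals M T => if demand a = θ + n then (1 : ℝ) else 0)
    with hpe
  set pl := cycleExp lam (fun a : CycleArrivals M T => if demand a < θ then (1 : ℝ) else 0)
    with hpl
  have hT : θ + n ≤ T := by
    have : ((θ + n : ℕ) : ℝ) ≤ T := by nlinarith [(Nat.cast_nonneg T : (0 : ℝ) ≤ T)]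
    exact_mod_cast this
  have hpos : 0 < pe := cycleExp_demand_eq_pos h0 hp hT
  have htail : 2 ^ n * pl ≤ pe := two_pow_mul_cycleExp_demand_lt_le hlam h0 hp hn
  have hdrift : ∀ s : SystemState L, s.position ≤ S →
      evolve lam T S (fun s => (shortfall S θ s : ℝ)) s + pe * b s
        ≤ shortfall S θ s + θ * pl := by
    intro s hs
    have h := cycleExp_mono (T := T) hlam h0
      (F := fun a => (shortfall S θ (step S s a) : ℝ) + b s * if demand a = θ + n then 1 else 0)
      (G := fun a => (shortfall S θ s : ℝ) + θ * if demand a < θ then 1 else 0)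
      (fun a => by
        have := shortfall_step_le (Nat.le_add_right θ n) hs a
        simp only [hb]
        exact_mod_cast this)
    rw [cycleExp_add, cycleExp_add, cycleExp_const_mul, cycleExp_const_mul, cycleExp_const] at h
    rw [mul_comm pe]
    exact h
  -- In stationarity the mean shortfall does not change, so gains and losses balance; the demand of
  -- a cycle is independent of its initial state.
  have h := stationaryMean_mono (T := T) hlam h0 hdrift
  rw [stationaryMean_add hlam h0, stationaryMean_add hlam h0, stationaryMean_const hlam h0,
    stationaryMean_const_mul hlam h0] at h
  have h1 := stationaryMean_evolve_iterate (T := T) (S := S) hlam h0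
    (fun s : SystemState L => (shortfall S θ s : ℝ)) 1
  rw [Function.iterate_one] at h1
  have h1' : stationaryMean lam T S (fun s => evolve lam T S
      (fun s : SystemState L => (shortfall S θ s : ℝ)) s) = stationaryMean lam T S
      (fun s : SystemState L => (shortfall S θ s : ℝ)) := h1
  rw [h1'] at h
  have h2 : pe * stationaryMean lam T S b ≤ θ * pl := by linarith
  have h3 : (θ : ℝ) * pl ≤ pe * (θ / 2 ^ n) := by
    have : pl ≤ pe / 2 ^ n := by
      rw [le_div_iff₀ (by positivity)]
      linarith
    calc (θ : ℝ) * pl ≤ θ * (pe / 2 ^ n) := mul_le_mul_of_nonneg_left this (Nat.cast_nonneg _)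
      _ = _ := by ring
  exact le_of_mul_le_mul_left (h2.trans h3) hpos

end Drift

/-! ### Windows of consecutive cycles. -/

section Window

variable {M T S L : ℕ} [NeZero L] {lam : Fin M → ℝ}

lemma outstanding_step {s : SystemState L} (hs : s.position ≤ S) (a : CycleArrivals M T)
    (i : Fin L) : outstanding S (step S s a) i
      = if hi : i.val + 1 < L then outstanding S s ⟨i.val + 1, hi⟩
        else min s.onHand (demand a) := by
  by_cases hi : i.val + 1 < L
  · rw [dif_pos hi, outstanding, dif_pos (by omega)]
    rfl
  · rw [dif_neg hi, outstanding, dif_neg (by omega), newOrder_step hs]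

/-- An order equals the sales of the cycle before it was placed; slot `i` in cycle `n` holds the
sales of cycle `i + n - L`. -/
lemma outstanding_trajectory {s : SystemState L} (hs : s.position ≤ S)
    (H : ℕ → CycleArrivals M T) (n : ℕ) (i : Fin L) {k : ℕ} (hk : k + L = i.val + n) :
    outstanding S (trajectory S s H n) i
      = min (trajectory S s H k).onHand (demand (H k)) := by
  induction n generalizing i with
  | zero => exact absurd i.isLt (by omega)
  | succ n ih =>
    rw [trajectory, outstanding_step (position_trajectory_le hs H n)]
    split_ifs with hi
    · exact ih ⟨i.val + 1, hi⟩ (by simp only; omega)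
    · have := i.isLt
      obtain rfl : k = n := by omega
      rfl

/-- The stock on hand and the sales of the preceding `L` cycles add up to the base-stock level. -/
lemma onHand_add_sum_sales {s : SystemState L} (hs : s.position ≤ S)
    (H : ℕ → CycleArrivals M T) (k : ℕ) :
    (trajectory S s H (k + L)).onHand
      + ∑ i ∈ Finset.range L, min (trajectory S s H (k + i)).onHand (demand (H (k + i))) = S := by
  rw [Finset.sum_range]
  refine Eq.trans ?_ (onHand_add_sum_outstanding (position_trajectory_le hs H (k + L)))
  congr 1
  exact Finset.sum_congr rfl fun i _ =>
    (outstanding_trajectory hs H (k + L) i (by omega)).symm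

/-- In `2 L + 2` consecutive cycles, there is one with a moderate stock, or one with a large stock
followed by a small order, or one with low demand. -/
lemma exists_moderate_or_drop_or_low {θ m : ℕ} {v : ℝ} (hθS : (L + 1) * θ ≤ S)
    (hv : (S : ℝ) < (L + 1) * v) (hm : (m : ℝ) ≤ v) {s : SystemState L} (hs : s.position ≤ S)
    (H : ℕ → CycleArrivals M T) :
    ∃ n < 2 * L + 2, (θ ≤ (trajectory S s H n).onHand ∧ ((trajectory S s H n).onHand : ℝ) ≤ v) ∨
      (m < (trajectory S s H n).onHand ∧ outstanding S (trajectory S s H n) 0 < θ) ∨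
      (demand (H n) : ℝ) < v := by
  by_contra! hcon
  set I : ℕ → ℕ := fun n => (trajectory S s H n).onHand with hI
  have hmid : ∀ n < 2 * L + 2, θ ≤ I n → v < I n := fun n hn h => (hcon n hn).1 h
  -- Otherwise stock and sales over cycles `0, ..., L` would add up to less than `(L + 1) θ ≤ S`.
  obtain ⟨k₁, hk₁, hfull⟩ : ∃ k ≤ L, θ ≤ I k := by
    by_contra! hlt
    have h := onHand_add_sum_sales hs H 0
    simp only [zero_add] at h
    have h1 : ∑ i ∈ Finset.range L, min (trajectory S s H i).onHand (demand (H i))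
        ≤ ∑ i ∈ Finset.range L, θ :=
      Finset.sum_le_sum fun i hi =>
        (min_le_left _ _).trans (hlt i (Finset.mem_range.1 hi).le).le
    rw [Finset.sum_const, Finset.card_range, smul_eq_mul] at h1
    have h2 : (trajectory S s H L).onHand < θ := hlt L le_rfl
    rw [add_mul, one_mul] at hθS
    omega
  -- A stock above `v` is followed by an order of at least `θ`; the next stock is then at least `θ`
  -- and, not being moderate, again above `v`.
  have hstay : ∀ j, k₁ + j < 2 * L + 2 → v < I (k₁ + j) := by
    intro j
    induction j with
    | zero => exact fun h => hmid _ h hfull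
    | succ j ih =>
      intro hj
      have h1 := ih (by omega)
      have h2 := (hcon (k₁ + j) (by omega)).2.1 (by exact_mod_cast hm.trans_lt h1)
      refine hmid _ hj (h2.trans ?_)
      change _ ≤ (step S (trajectory S s H (k₁ + j)) (H (k₁ + j))).onHand
      rw [onHand_step]
      exact Nat.le_add_left _ _
  have hlate : ∀ n, L ≤ n → n < 2 * L + 2 → v < I n := fun n h1 h2 => by
    have := hstay (n - k₁) (by omega)
    rwa [Nat.add_sub_cancel' (by omega)] at this
  -- In cycles `L + 1, ..., 2 L + 1` stocks exceed `v` and demands are at least `v`, so stock plus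
  -- sales exceed `(L + 1) v > S`.
  have h := onHand_add_sum_sales hs H (L + 1)
  have h1 : ∑ i ∈ Finset.range L, v ≤ ∑ i ∈ Finset.range L,
      ((min (trajectory S s H (L + 1 + i)).onHand (demand (H (L + 1 + i))) : ℕ) : ℝ) := by
    refine Finset.sum_le_sum fun i hi => ?_
    have := Finset.mem_range.1 hi
    rw [Nat.cast_min]
    exact le_min (hlate _ (by omega) (by omega)).le (hcon _ (by omega)).2.2
  rw [Finset.sum_const, Finset.card_range, nsmul_eq_mul] at h1
  have h2 : v < ((trajectory S s H (L + 1 + L)).onHand : ℝ) := hlate _ (by omega) (by omega)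
  have h3 : (S : ℝ) = ((trajectory S s H (L + 1 + L)).onHand : ℝ)
      + ∑ i ∈ Finset.range L,
        ((min (trajectory S s H (L + 1 + i)).onHand (demand (H (L + 1 + i))) : ℕ) : ℝ) := by
    exact_mod_cast h.symm
  linarith

/-- In stationarity, moderate stocks on hand are not rare. -/
lemma one_le_stationaryMean_moderate (hlam : ∀ j, 0 ≤ lam j) (h0 : 0 < 1 - ∑ j, lam j)
    (hp : 0 < ∑ j, lam j) {θ n : ℕ} {γ : ℝ} (hγ : 0 < γ) (hθS : (L + 1) * θ ≤ S)
    (hv : (S : ℝ) < (L + 1) * (T * (∑ j, lam j) - γ)) (hγ' : γ ≤ T * (∑ j, lam j) / 2)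
    (hn : ((θ + n : ℕ) : ℝ) ≤ T * (∑ j, lam j) / 2) :
    1 ≤ (2 * L + 2) * (stationaryMean lam T S (fun s : SystemState L =>
      if θ ≤ s.onHand ∧ (s.onHand : ℝ) ≤ T * (∑ j, lam j) - γ then 1 else 0)
        + θ / 2 ^ n + T / γ ^ 2) := by
  set v := T * (∑ j, lam j) - γ with hvdef
  set mid : SystemState L → ℝ := fun s =>
    if θ ≤ s.onHand ∧ (s.onHand : ℝ) ≤ v then 1 else 0 with hmid
  set bad : SystemState L → ℝ := fun s =>
    if θ + n < s.onHand ∧ outstanding S s 0 < θ then 1 else 0 with hbad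
  set low : CycleArrivals M T → ℝ := fun a => if (demand a : ℝ) < v then 1 else 0 with hlow
  have nmid : ∀ s, 0 ≤ mid s := fun s => by simp only [hmid]; split_ifs <;> norm_num
  have nbad : ∀ s, 0 ≤ bad s := fun s => by simp only [hbad]; split_ifs <;> norm_num
  have nlow : ∀ a, 0 ≤ low a := fun a => by simp only [hlow]; split_ifs <;> norm_num
  have h := le_sum_stationaryMean (T := T) (S := S) (L := L) hlam h0 (N := 2 * L + 2) (c := 1)
    (φ := fun _ s a => mid s + bad s + low a) (fun s hs H => by
      obtain ⟨k, hk, hcase⟩ := exists_moderate_or_drop_or_low (m := θ + n) hθS hv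
        (by linarith) hs H
      refine le_trans ?_ (Finset.single_le_sum (f := fun k => mid (trajectory S s H k)
        + bad (trajectory S s H k) + low (H k))
        (fun k _ => by have := nmid (trajectory S s H k); have := nbad (trajectory S s H k)
                       have := nlow (H k); positivity) (Finset.mem_range.2 hk))
      have e1 := nmid (trajectory S s H k)
      have e2 := nbad (trajectory S s H k)
      have e3 := nlow (H k)
      rcases hcase with hc | hc | hc
      · have : mid (trajectory S s H k) = 1 := if_pos hc
        linarith
      · have : bad (trajectory S s H k) = 1 := if_pos hc
        linarith
      · have : low (H k) = 1 := if_pos hc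
        linarith)
  simp only [cycleExp_add, cycleExp_const, Finset.sum_const, Finset.card_range, nsmul_eq_mul] at h
  rw [stationaryMean_add hlam h0, stationaryMean_add hlam h0, stationaryMean_const hlam h0] at h
  have h1 : stationaryMean lam T S bad ≤ θ / 2 ^ n := stationaryMean_large_small_le hlam h0 hp hn
  have h2 : cycleExp lam low ≤ T / γ ^ 2 := cycleExp_demand_lt_le hlam h0 hγ
  push_cast at h
  refine h.trans (mul_le_mul_of_nonneg_left (by linarith) (by positivity))

/-- The expected lost sales, and with them the advantage of the offline rule, are bounded by the
slack of the base-stock level. -/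
lemma stationaryMean_gapMean_le (hlam : ∀ j, 0 ≤ lam j) (h0 : 0 < 1 - ∑ j, lam j) (hT : 0 < T)
    {r : Fin M → ℝ} {R : ℝ} (hr0 : ∀ j, 0 < r j) (hR : ∀ j, r j ≤ R) (hR0 : 0 ≤ R)
    (hS : 0 ≤ slack L lam T S) :
    stationaryMean lam T S (fun s : SystemState L => gapMean r lam T s.onHand)
      ≤ R * (slack L lam T S + (L + 1) * √T) := by
  set d := (T : ℝ) * ∑ j, lam j with hd
  set lost : SystemState L → ℝ := fun s =>
    cycleExp lam fun a : CycleArrivals M T => ((demand a - s.onHand : ℕ) : ℝ) with hlost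
  -- Pathwise, the lost sales of cycle `L` are at most the slack plus the absolute demand deviations
  -- of cycles `0, ..., L`; the coefficient `-1` at `n = L` singles them out.
  have h := le_sum_stationaryMean (T := T) (S := S) (L := L) hlam h0 (N := L + 1)
    (c := -slack L lam T S)
    (φ := fun n s a => |(demand a : ℝ) - d|
      + (if n = L then -1 else 0) * ((demand a - s.onHand : ℕ) : ℝ)) (fun s hs H => by
      have hw := onHand_add_sum_sales hs H 0
      simp only [zero_add] at hw
      have hsales : ∑ i ∈ Finset.range L, min (trajectory S s H i).onHand (demand (H i))
          ≤ ∑ i ∈ Finset.range L, demand (H i) := Finset.sum_le_sum fun i _ => min_le_right _ _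
      have hSle : S ≤ (trajectory S s H L).onHand + ∑ i ∈ Finset.range L, demand (H i) := by omega
      have hSle' : (S : ℝ) ≤ (trajectory S s H L).onHand
          + ∑ i ∈ Finset.range L, (demand (H i) : ℝ) := by exact_mod_cast hSle
      have habs : ∑ i ∈ Finset.range (L + 1), ((demand (H i) : ℝ) - d)
          ≤ ∑ i ∈ Finset.range (L + 1), |(demand (H i) : ℝ) - d| :=
        Finset.sum_le_sum fun i _ => le_abs_self _
      have hnn : 0 ≤ ∑ i ∈ Finset.range (L + 1), |(demand (H i) : ℝ) - d| :=
        Finset.sum_nonneg fun i _ => abs_nonneg _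
      rw [Finset.sum_add_distrib]
      simp only [ite_mul, zero_mul, Finset.sum_ite_eq', Finset.mem_range, Nat.lt_succ_self,
        if_true, neg_one_mul]
      rw [Finset.sum_sub_distrib, Finset.sum_const, Finset.card_range, nsmul_eq_mul,
        Finset.sum_range_succ] at habs
      unfold slack at *
      rcases le_total (demand (H L)) (trajectory S s H L).onHand with hle | hle
      · rw [Nat.sub_eq_zero_of_le hle, Nat.cast_zero]
        linarith
      · rw [Nat.cast_sub hle]
        push_cast at habs
        rw [hd] at habs ⊢
        rw [hd] at hnn
        linarith)
  simp only [cycleExp_add, cycleExp_const_mul] at h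
  have hterm : ∀ n ∈ Finset.range (L + 1), stationaryMean lam T S (fun s : SystemState L =>
      cycleExp lam (fun a : CycleArrivals M T => |(demand a : ℝ) - d|)
        + (if n = L then -1 else 0) * cycleExp lam
          (fun a : CycleArrivals M T => ((demand a - s.onHand : ℕ) : ℝ)))
      = cycleExp lam (fun a : CycleArrivals M T => |(demand a : ℝ) - d|)
        + (if n = L then -1 else 0) * stationaryMean lam T S lost := fun n _ => by
    rw [stationaryMean_add hlam h0, stationaryMean_const hlam h0, stationaryMean_const_mul hlam h0]
  rw [Finset.sum_congr rfl hterm, Finset.sum_add_distrib, Finset.sum_const, Finset.card_range,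
    nsmul_eq_mul] at h
  simp only [ite_mul, zero_mul, Finset.sum_ite_eq', Finset.mem_range, Nat.lt_succ_self,
    if_true, neg_one_mul] at h
  have hdev := cycleExp_abs_demand_sub_le (lam := lam) hlam h0 hT
  have h1 : stationaryMean lam T S (fun s : SystemState L => gapMean r lam T s.onHand)
      ≤ R * stationaryMean lam T S lost := by
    rw [← stationaryMean_const_mul hlam h0]
    refine stationaryMean_mono hlam h0 fun s _ => ?_
    rw [hlost, ← cycleExp_const_mul]
    exact cycleExp_mono hlam h0 fun a => rewardGap_le hr0 hR hR0 _ a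
  refine h1.trans (mul_le_mul_of_nonneg_left ?_ hR0)
  have h2 : ((L : ℝ) + 1) * cycleExp lam (fun a : CycleArrivals M T => |(demand a : ℝ) - d|)
      ≤ (L + 1) * √T := mul_le_mul_of_nonneg_left hdev (by positivity)
  push_cast at h
  linarith

end Window

/-! ### Choice of constants for moderate stocks. -/

lemma div_half_mul_sq_le {x l : ℝ} (hx : 0 < x) (hl : 0 < l) (h : 24 ≤ x * l ^ 2) :
    x / (x * l / 2) ^ 2 ≤ 1 / 6 := by
  rw [div_le_iff₀ (by positivity)]
  have := mul_le_mul_of_nonneg_left h hx.le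
  linarith

/-- The advantage of the offline rule in a cycle that starts with a moderate stock. -/
lemma exists_mul_le_gapMean {M : ℕ} {r lam : Fin M → ℝ} (hr : StrictMono r) (hr0 : ∀ j, 0 < r j)
    (hlam : ∀ j, 0 ≤ lam j) (h0 : 0 < 1 - ∑ j, lam j) {i j : Fin M} (hij : i < j)
    (hi : 0 < lam i) (hj : 0 < lam j) {α : ℝ} (hα : 0 < α) (hα1 : α ≤ 1) :
    ∃ c C : ℝ, 0 < c ∧ 0 < C ∧ ∀ (T I : ℕ) (γ : ℝ), C ≤ γ → C * T ≤ γ ^ 2 →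
      γ ≤ T * (∑ j, lam j) / 2 → ⌊α * T⌋₊ ≤ I → (I : ℝ) ≤ T * (∑ j, lam j) - γ →
      c * γ ≤ gapMean r lam T I := by
  set p := ∑ j, lam j with hp
  have hrij : 0 < r j - r i := sub_pos.2 (hr hij)
  -- With `g ≥ γ / 4` late periods and `θ ≥ α γ` early ones, `k ≤ c₀ γ` is at most half the expected
  -- count of type `j`, respectively type `i`.
  set c₀ := min (lam j / 8) (α * lam i / 2) with hc₀
  have hc₀pos : 0 < c₀ := lt_min (by positivity) (by positivity)
  -- The summands of `C` absorb the roundings and make each of the three Chebyshev terms at most `1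
  -- / 6`, so the exchange succeeds with probability at least `1 / 2`.
  refine ⟨(r j - r i) * (c₀ / 2) * (1 / 2),
    24 + 2 / c₀ + 1 / α + 24 / (α * lam i ^ 2) + 96 / lam j ^ 2, by positivity, by positivity, ?_⟩
  intro T I γ hCγ hCT hγT hθI hIγ
  have q1 : 0 < 2 / c₀ := by positivity
  have q2 : 0 < 1 / α := by positivity
  have q3 : 0 < 24 / (α * lam i ^ 2) := by positivity
  have q4 : 0 < 96 / lam j ^ 2 := by positivity
  have hT0 : (0 : ℝ) ≤ T := Nat.cast_nonneg T
  have g24 : 24 ≤ γ := by linarith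
  have hγ0 : 0 < γ := by linarith
  have gc : 2 ≤ c₀ * γ := by
    have : 2 / c₀ ≤ γ := by linarith
    rwa [div_le_iff₀ hc₀pos, mul_comm] at this
  have gα : 1 ≤ α * γ := by
    have : 1 / α ≤ γ := by linarith
    rwa [div_le_iff₀ hα, mul_comm] at this
  have gi : 24 ≤ α * γ * lam i ^ 2 := by
    have : 24 / (α * lam i ^ 2) ≤ γ := by linarith
    rw [div_le_iff₀ (by positivity)] at this
    linarith
  have gj : 96 ≤ γ * lam j ^ 2 := by
    have : 96 / lam j ^ 2 ≤ γ := by linarith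
    rwa [div_le_iff₀ (by positivity)] at this
  have gT : 24 * T ≤ γ ^ 2 := by
    refine le_trans (mul_le_mul_of_nonneg_right ?_ hT0) hCT
    linarith
  have hTγ : 2 * γ ≤ T := by
    have : (T : ℝ) * p ≤ T := mul_le_of_le_one_right hT0 (by linarith)
    linarith
  set θ := ⌊α * T⌋₊ with hθ
  set g := ⌊γ / 2⌋₊ with hg
  set k := ⌊c₀ * γ⌋₊ with hk
  have hθ1 : α * γ ≤ θ := by
    have h1 := Nat.lt_floor_add_one (α * T)
    have h2 : α * (2 * γ) ≤ α * T := mul_le_mul_of_nonneg_left hTγ hα.le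
    rw [← hθ] at h1
    linarith
  have hθT : θ ≤ T := by
    have : (θ : ℝ) ≤ T := (Nat.floor_le (by positivity)).trans
      (mul_le_of_le_one_left hT0 hα1)
    exact_mod_cast this
  have hg1 : γ / 4 ≤ g := by
    have h1 := Nat.lt_floor_add_one (γ / 2)
    rw [← hg] at h1
    linarith
  have hg2 : (g : ℝ) ≤ γ / 2 := Nat.floor_le (by linarith)
  have hgT : g ≤ T := by
    have : (g : ℝ) ≤ T := by linarith
    exact_mod_cast this
  have hk1 : c₀ * γ / 2 ≤ k := by
    have h1 := Nat.lt_floor_add_one (c₀ * γ)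
    rw [← hk] at h1
    linarith
  have hk2 : (k : ℝ) ≤ c₀ * γ := Nat.floor_le (by positivity)
  have hθ0 : (0 : ℝ) < θ := by linarith
  have hg0 : (0 : ℝ) < g := by linarith
  -- The margin `γ` is split: one half pays for giving up the last `g` periods, the other is the
  -- Chebyshev margin `u₂`.
  have hmain := le_gapMean (T := T) hr hr0 hlam h0 hij (I := I) (t₁ := θ) (g := g) (k := k)
    hθI hθT hgT (u₁ := θ * lam i / 2) (u₂ := γ / 2) (u₃ := g * lam j / 2) (by positivity)
    (by positivity) (by positivity) ?_ ?_ ?_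
  · have e1 : (θ : ℝ) / (θ * lam i / 2) ^ 2 ≤ 1 / 6 :=
      div_half_mul_sq_le hθ0 hi (gi.trans (mul_le_mul_of_nonneg_right hθ1 (by positivity)))
    have e2 : (T : ℝ) / (γ / 2) ^ 2 ≤ 1 / 6 := by
      rw [div_le_iff₀ (by positivity)]
      linarith
    have e3 : (g : ℝ) / (g * lam j / 2) ^ 2 ≤ 1 / 6 := by
      refine div_half_mul_sq_le hg0 hj ?_
      have := mul_le_mul_of_nonneg_right hg1 (by positivity : 0 ≤ lam j ^ 2)
      linarith
    refine le_trans ?_ hmain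
    calc (r j - r i) * (c₀ / 2) * (1 / 2) * γ = (r j - r i) * (c₀ * γ / 2) * (1 / 2) := by ring
      _ ≤ (r j - r i) * k * (1 / 2) := by gcongr
      _ ≤ _ := mul_le_mul_of_nonneg_left (by linarith) (by positivity)
  · have h1 : c₀ * γ ≤ α * lam i / 2 * γ := mul_le_mul_of_nonneg_right (min_le_right _ _) hγ0.le
    have h2 := mul_le_mul_of_nonneg_right hθ1 hi.le
    linarith
  · rw [Nat.cast_sub hgT]
    have hp1 : p ≤ 1 := by linarith
    have : (g : ℝ) * p ≤ γ / 2 * 1 := mul_le_mul hg2 hp1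
      (Finset.sum_nonneg fun j _ => hlam j) (by linarith)
    linarith
  · have h1 : c₀ * γ ≤ lam j / 8 * γ := mul_le_mul_of_nonneg_right (min_le_left _ _) hγ0.le
    have h2 := mul_le_mul_of_nonneg_right hg1 hj.le
    linarith

/-! ### Asymptotics in the interior regime. -/

section Regime

variable {M L : ℕ} [NeZero L] {r lam : Fin M → ℝ}

lemma tendsto_floor_div_two_pow {a b : ℝ} (hb : 0 < b) (hab : a ≤ b) :
    Tendsto (fun T : ℕ => (⌊a * T⌋₊ : ℝ) / 2 ^ ⌊b * T⌋₊) atTop (𝓝 0) := by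
  have h1 : Tendsto (fun n : ℕ => (n : ℝ) ^ 1 / 2 ^ n) atTop (𝓝 0) :=
    tendsto_pow_const_div_const_pow_of_one_lt 1 (by norm_num)
  have h2 : Tendsto (fun T : ℕ => ⌊b * (T : ℝ)⌋₊) atTop atTop :=
    tendsto_nat_floor_atTop.comp (tendsto_natCast_atTop_atTop.const_mul_atTop hb)
  refine squeeze_zero (fun T => by positivity) (fun T => ?_) (h1.comp h2)
  simp only [Function.comp, pow_one]
  gcongr

/-- In the interior regime, the offline rule gains at least of order `T ^ β` in stationarity. -/
lemma exists_mul_rpow_le_stationaryMean (hr : StrictMono r) (hr0 : ∀ j, 0 < r j)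
    (hlam : ∀ j, 0 ≤ lam j) (h0 : 0 < 1 - ∑ j, lam j) {top : Fin M} (htop : ∀ i, i ≤ top)
    (hlamtop : 0 < lam top) {β : ℝ} (hβ : 1 / 2 < β) {S : ℕ → ℕ}
    (hS : InteriorRegime L lam (lam top) β S) :
    ∃ c : ℝ, 0 < c ∧ ∀ᶠ T : ℕ in atTop, c * (T : ℝ) ^ β
      ≤ stationaryMean lam T (S T) fun s : SystemState L => gapMean r lam T s.onHand := by
  obtain ⟨hbounds, K₁, K₂, hK₁, -, hslack⟩ := hS
  set p := ∑ j, lam j with hp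
  have hL1 : (0 : ℝ) < L + 1 := by positivity
  -- If only the top type occurred, the two strict bounds on `S T` would contradict each other.
  obtain ⟨i, hi, hne⟩ : ∃ i, 0 < lam i ∧ i ≠ top := by
    by_contra! hcon
    obtain ⟨T, hT⟩ := hbounds.exists
    have : p = lam top := Finset.sum_eq_single_of_mem top (Finset.mem_univ _) fun j _ hj =>
      le_antisymm (not_lt.1 fun h => hj (hcon j h)) (hlam j)
    rw [this] at hT
    linarith [hT.1, hT.2]
  have hp0 : 0 < p := lt_of_lt_of_le hlamtop
    (Finset.single_le_sum (f := lam) (fun j _ => hlam j) (Finset.mem_univ top))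
  have hp1 : p ≤ 1 := by linarith
  -- `lam top` ensures `(L + 1) θ ≤ S T`; `p / 8` keeps `θ + n` below half the mean demand for `n =
  -- ⌊p / 8 * T⌋₊` and lets `θ / 2 ^ n` vanish.
  set α := min (lam top) (p / 8) with hα
  have hα0 : 0 < α := lt_min hlamtop (by positivity)
  have hα8 : α ≤ p / 8 := min_le_right _ _
  obtain ⟨c, C, hc, hC, hgap⟩ := exists_mul_le_gapMean hr hr0 hlam h0
    (lt_of_le_of_ne (htop i) hne) hi hlamtop hα0 (by linarith)
  set κ := K₁ / (2 * (L + 1)) with hκ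
  have hκ0 : 0 < κ := by positivity
  set N : ℝ := 2 * L + 2 with hN
  have hN0 : 0 < N := by positivity
  refine ⟨c * κ * (1 / (2 * N)), by positivity, ?_⟩
  have hrpow : Tendsto (fun T : ℕ => κ * (T : ℝ) ^ β) atTop atTop :=
    ((tendsto_rpow_atTop (by linarith)).comp tendsto_natCast_atTop_atTop).const_mul_atTop hκ0
  -- Here `β > 1/2` is essential: `γ ^ 2` must outgrow every multiple of `T`.
  have hrpow2 : Tendsto (fun T : ℕ => κ ^ 2 * (T : ℝ) ^ (2 * β - 1)) atTop atTop :=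
    ((tendsto_rpow_atTop (by linarith)).comp tendsto_natCast_atTop_atTop).const_mul_atTop
      (by positivity)
  have hexp := (tendsto_floor_div_two_pow (a := α) (b := p / 8) (by positivity) hα8).eventually
    (gt_mem_nhds (by positivity : 0 < 1 / (4 * N)))
  filter_upwards [hbounds, hslack, hrpow.eventually_ge_atTop C,
    hrpow2.eventually_ge_atTop (C + 4 * N), hexp, eventually_gt_atTop 0]
    with T hbT hsT hCT hC2 heT hT
  have hT0 : (0 : ℝ) < T := by exact_mod_cast hT
  have hTβ : 0 < (T : ℝ) ^ β := Real.rpow_pos_of_pos hT0 β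
  set σ := slack L lam T (S T) with hσ
  set γ := σ / (2 * (L + 1)) with hγ
  -- The factor `2` leaves room: `S T = (L + 1) (T p - 2 γ)` lies strictly below `(L + 1) (T p -
  -- γ)`.
  have hσγ : σ = 2 * (L + 1) * γ := by
    rw [hγ]
    field_simp
  have hκγ : κ * (T : ℝ) ^ β ≤ γ := by
    rw [hκ, hγ, div_mul_eq_mul_div]
    gcongr
    exact hsT.1
  have hγ0 : 0 < γ := lt_of_lt_of_le (by positivity) hκγ
  have hsq : (C + 4 * N) * T ≤ γ ^ 2 := by
    calc (C + 4 * N) * T ≤ κ ^ 2 * (T : ℝ) ^ (2 * β - 1) * T := by gcongr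
      _ = (κ * (T : ℝ) ^ β) ^ 2 := by
        have h1 : (T : ℝ) ^ (2 * β - 1) * T = (T : ℝ) ^ β * (T : ℝ) ^ β := by
          rw [← Real.rpow_add_one hT0.ne', ← Real.rpow_add hT0]
          congr 1
          ring
        rw [mul_assoc, h1]
        ring
      _ ≤ γ ^ 2 := pow_le_pow_left₀ (by positivity) hκγ 2
  have hσdef : σ = (L + 1) * T * p - S T := rfl
  have hS0 : (0 : ℝ) ≤ S T := Nat.cast_nonneg _
  have hγhalf : γ ≤ T * p / 2 := by
    have : (L + 1) * (2 * γ) ≤ (L + 1) * (T * p) := by linarith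
    linarith [le_of_mul_le_mul_left this hL1]
  have hv : (S T : ℝ) < (L + 1) * (T * p - γ) := by
    have : 0 < (L + 1) * γ := by positivity
    linarith
  set θ := ⌊α * T⌋₊ with hθ
  have hθle : (θ : ℝ) ≤ α * T := Nat.floor_le (by positivity)
  have hnle : (⌊p / 8 * T⌋₊ : ℝ) ≤ p / 8 * T := Nat.floor_le (by positivity)
  have hθS : (L + 1) * θ ≤ S T := by
    have h1 : ((L : ℝ) + 1) * θ ≤ (L + 1) * (lam top * T) :=
      mul_le_mul_of_nonneg_left (hθle.trans
        (mul_le_mul_of_nonneg_right (min_le_left _ _) hT0.le)) hL1.le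
    have h2 : ((L : ℝ) + 1) * θ ≤ S T := by linarith [hbT.1]
    exact_mod_cast h2
  have hn : ((θ + ⌊p / 8 * T⌋₊ : ℕ) : ℝ) ≤ T * p / 2 := by
    push_cast
    have : α * T ≤ p / 8 * T := mul_le_mul_of_nonneg_right hα8 hT0.le
    nlinarith
  have hmid := one_le_stationaryMean_moderate (T := T) (S := S T) (L := L) hlam h0 hp0 hγ0 hθS hv
    hγhalf hn
  set μ := stationaryMean lam T (S T) (fun s : SystemState L =>
    if θ ≤ s.onHand ∧ (s.onHand : ℝ) ≤ T * (∑ j, lam j) - γ then 1 else 0) with hμ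
  have hTγ : (T : ℝ) / γ ^ 2 ≤ 1 / (4 * N) := by
    rw [div_le_div_iff₀ (by positivity) (by positivity)]
    nlinarith
  -- Of the average share `1 / N` per cycle of the window, the two rare events take at most `1 / (4
  -- N)` each.
  have hμ2 : 1 / (2 * N) ≤ μ := by
    have h1 : 1 ≤ N * (μ + 1 / (4 * N) + 1 / (4 * N)) := hmid.trans
      (mul_le_mul_of_nonneg_left (by linarith) hN0.le)
    have h2 : N * (μ + 1 / (4 * N) + 1 / (4 * N)) = N * μ + 1 / 2 := by
      field_simp
      ring
    rw [div_le_iff₀ (by positivity)]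
    linarith
  have hfin : c * γ * μ
      ≤ stationaryMean lam T (S T) fun s : SystemState L => gapMean r lam T s.onHand := by
    rw [hμ, ← stationaryMean_const_mul hlam h0]
    refine stationaryMean_mono hlam h0 fun s _ => ?_
    split_ifs with hs
    · rw [mul_one]
      exact hgap T s.onHand γ (hCT.trans hκγ)
        (le_trans (mul_le_mul_of_nonneg_right (by linarith) hT0.le) hsq) hγhalf hs.1 hs.2
    · rw [mul_zero]
      exact gapMean_nonneg hr hr0 hlam h0 _
  refine le_trans ?_ hfin
  rw [mul_right_comm, mul_assoc c]
  gcongr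

/-- In the interior regime, the offline rule gains at most of order `T ^ β` in stationarity. -/
lemma exists_stationaryMean_le_mul_rpow (hr : Monotone r) (hr0 : ∀ j, 0 < r j)
    (hlam : ∀ j, 0 ≤ lam j) (h0 : 0 < 1 - ∑ j, lam j) {top : Fin M} (htop : ∀ i, i ≤ top)
    {β : ℝ} (hβ : 1 / 2 < β) {S : ℕ → ℕ} {ℓ : ℝ} (hS : InteriorRegime L lam ℓ β S) :
    ∃ C : ℝ, ∀ᶠ T : ℕ in atTop,
      stationaryMean lam T (S T) (fun s : SystemState L => gapMean r lam T s.onHand)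
        ≤ C * (T : ℝ) ^ β := by
  obtain ⟨-, K₁, K₂, hK₁, -, hslack⟩ := hS
  refine ⟨r top * (K₂ + (L + 1)), ?_⟩
  filter_upwards [hslack, eventually_gt_atTop 0] with T hsT hT
  have hT1 : (1 : ℝ) ≤ T := by exact_mod_cast hT
  have hs0 : 0 ≤ slack L lam T (S T) := le_trans (by positivity) hsT.1
  refine (stationaryMean_gapMean_le hlam h0 hT hr0 (fun j => hr (htop j)) (hr0 top).le hs0).trans ?_
  rw [mul_assoc]
  refine mul_le_mul_of_nonneg_left ?_ (hr0 top).le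
  have h1 : √(T : ℝ) ≤ (T : ℝ) ^ β := by
    rw [Real.sqrt_eq_rpow]
    exact Real.rpow_le_rpow_of_exponent_le hT1 hβ.le
  have h2 : ((L : ℝ) + 1) * √T ≤ (L + 1) * (T : ℝ) ^ β :=
    mul_le_mul_of_nonneg_left h1 (by positivity)
  linarith [hsT.2]

/-- The equal leftovers give one chain for both rules, and the holding costs cancel. The initial
states may differ, as the limits do not depend on them. -/
lemma longRunProfit_offline_sub_greedy (hlam : ∀ j, 0 ≤ lam j) (h0 : 0 < 1 - ∑ j, lam j)
    (h : ℝ) {T S : ℕ} {s s' : SystemState L} (hs : s.position ≤ S) (hs' : s'.position ≤ S) :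
    longRunProfit r lam h (offlineRule M T) S s - longRunProfit r lam h (greedyRule M T) S s'
      = stationaryMean lam T S fun s : SystemState L => gapMean r lam T s.onHand := by
  rw [longRunProfit_eq hlam h0 leftover_offline r h hs,
    longRunProfit_eq hlam h0 leftover_greedy r h hs', sub_eq_iff_eq_add,
    ← stationaryMean_add hlam h0]
  congr 1
  ext u
  rw [gapMean, ← cycleExp_add]
  congr 1
  ext a
  rw [← cycleProfit_offline_sub_greedy r h, sub_add_cancel]

end Regime

end Replenishment

theorem mainTheorem7 (M L : ℕ) [NeZero L] (hM : 2 ≤ M)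
    (r lam : Fin M → ℝ) (h : ℝ)
    (hr_pos : ∀ j, 0 < r j) (hr_mono : StrictMono r)
    (hlam_nonneg : ∀ j, 0 ≤ lam j)
    (hlam_top : 0 < lam ⟨M - 1, by omega⟩)
    (hlam_zero : 0 < 1 - ∑ j, lam j)
    (hh : 0 < h)
    (initOff initGreedy : ℕ → ℕ → Replenishment.SystemState L)
    (hinitOff : ∀ T S, (initOff T S).position ≤ S)
    (hinitGreedy : ∀ T S, (initGreedy T S).position ≤ S)
    (A : ℕ → Set ℕ) (Soff Sgreedy : ℕ → ℕ)
    (hSoff : ∀ᶠ T : ℕ in Filter.atTop, Replenishment.IsOptimalLevel (A T)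
      (fun S => Replenishment.longRunProfit r lam h
        (Replenishment.offlineRule M T) S (initOff T S)) (Soff T))
    (hSgreedy : ∀ᶠ T : ℕ in Filter.atTop, Replenishment.IsOptimalLevel (A T)
      (fun S => Replenishment.longRunProfit r lam h
        (Replenishment.greedyRule M T) S (initGreedy T S)) (Sgreedy T))
    (β : ℝ) (hβ : 1 / 2 < β) (hβ_le : β ≤ 1)
    (hregOff : Replenishment.InteriorRegime L lam (lam ⟨M - 1, by omega⟩) β Soff)
    (hregGreedy : Replenishment.InteriorRegime L lam (lam ⟨M - 1, by omega⟩) β Sgreedy) :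
    (∀ (T S : ℕ) (s₀ : Replenishment.SystemState L), s₀.position ≤ S →
      Filter.Tendsto
        (Replenishment.avgProfit r lam h (Replenishment.offlineRule M T) S s₀) Filter.atTop
        (nhds (Replenishment.longRunProfit r lam h (Replenishment.offlineRule M T) S s₀)) ∧
      Filter.Tendsto
        (Replenishment.avgProfit r lam h (Replenishment.greedyRule M T) S s₀) Filter.atTop
        (nhds (Replenishment.longRunProfit r lam h (Replenishment.greedyRule M T) S s₀))) ∧
    Replenishment.ThetaPow
      (fun T =>
        Replenishment.longRunProfit r lam h
            (Replenishment.offlineRule M T) (Soff T) (initOff T (Soff T))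
          - Replenishment.longRunProfit r lam h
            (Replenishment.greedyRule M T) (Sgreedy T) (initGreedy T (Sgreedy T))) β := by
  have htop : ∀ i : Fin M, i ≤ ⟨M - 1, by omega⟩ := fun i => by
    have := i.isLt
    rw [Fin.le_def]
    change i.val ≤ M - 1
    omega
  refine ⟨fun T S s₀ hs => ⟨?_, ?_⟩, ?_⟩
  · rw [Replenishment.longRunProfit_eq hlam_nonneg hlam_zero Replenishment.leftover_offline r h hs]
    exact Replenishment.tendsto_avgProfit hlam_nonneg hlam_zero Replenishment.leftover_offline r h hs
  · rw [Replenishment.longRunProfit_eq hlam_nonneg hlam_zero Replenishment.leftover_greedy r h hs]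
    exact Replenishment.tendsto_avgProfit hlam_nonneg hlam_zero Replenishment.leftover_greedy r h hs
  · obtain ⟨c, hc, hlower⟩ := Replenishment.exists_mul_rpow_le_stationaryMean hr_mono hr_pos
      hlam_nonneg hlam_zero htop hlam_top hβ hregGreedy
    obtain ⟨C, hupper⟩ := Replenishment.exists_stationaryMean_le_mul_rpow hr_mono.monotone hr_pos
      hlam_nonneg hlam_zero htop hβ hregOff
    refine ⟨c, max c C, hc, le_max_left _ _, ?_⟩
    filter_upwards [hSoff, hSgreedy, hlower, hupper] with T hoff hgreedy hlow hup
    -- Each optimum is compared with the other rule's level: the lower bound is evaluated at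
    -- `Sgreedy T`, the upper bound at `Soff T`.
    have h1 := hoff.2 _ hgreedy.1
    have h2 := hgreedy.2 _ hoff.1
    have h3 := Replenishment.longRunProfit_offline_sub_greedy (T := T) (r := r) hlam_nonneg hlam_zero h
      (hinitOff T (Sgreedy T)) (hinitGreedy T (Sgreedy T))
    have h4 := Replenishment.longRunProfit_offline_sub_greedy (T := T) (r := r) hlam_nonneg hlam_zero h
      (hinitOff T (Soff T)) (hinitGreedy T (Soff T))
    have h5 : C * (T : ℝ) ^ β ≤ max c C * (T : ℝ) ^ β :=
      mul_le_mul_of_nonneg_right (le_max_right _ _) (Real.rpow_nonneg (Nat.cast_nonneg T) β)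
    constructor <;> linarith
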